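/- Let $\theta$ be an irrational real number, $\lambda=e^{2\pi i\theta}$, and let $A_\theta=C^*(U,V)$ be the irrational rotation algebra, generated by unitaries with $UV=\lambda VU$, with its canonical trace $\tau$. Let $H_\tau=L^2(A_\theta,\tau)$, with orthonormal basis $U^mV^n$ $(m,n\in\mathbb Z)$, let $U_l,V_l$ and $U_r,V_r$ be the operators on $H_\tau$ of left and of right multiplication by $U,V$, and let $A\subseteq B(H_\tau)$ be the weak closure of $A_\theta=C^*(U_l,V_l)$ (the hyperfinite $\mathrm{II}_1$ factor), with commutant $A'$. Let $CP(A)$ be the set of normal (ultraweakly continuous) unital completely positive maps $T:A\to A$. For $T\in CP(A)$ let $K_T$ be the Hilbert space obtained from the algebraic tensor product $A\otimes H_\tau$ and the form $\langle a\otimes h,b\otimes k\rangle=\langle h,T(a^*b)k\rangle$, let $\xi_T:H_\tau\to K_T$, $\xi_Th=1\otimes h$, and let $\pi_T(a)(b\otimes k)=ab\otimes k$ $(a\in A)$ and $\rho_T(a')(b\otimes k)=b\otimes a'k$ $(a'\in A')$; these are commuting $*$-representations on $K_T$, and $T(a)=\xi_T^*\pi_T(a)\xi_T$. The KSGNS bimodule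 $E_T\subseteq B(H_\tau,K_T)$ of $T$ is the strong-operator closure of $\operatorname{span}\pi_T(A)\xi_TA$, with left action $a\cdot R=\pi_T(a)R$, right action $R\cdot b=Rb$ and $A$-valued inner product $\langle R,Q\rangle=R^*Q$. Two maps $T,S\in CP(A)$ are KSGNS-equivalent if $E_T$ and $E_S$ are isomorphic, i.e. if there is a linear bijection $E_T\to E_S$ that preserves the $A$-valued inner products and intertwines the left and the right actions of $A$. Let $A_\theta^{(2)}\subseteq B(H_\tau\otimes H_\tau)$ be the norm closure of the $*$-algebra $A^{\mathrm{fin}}$ generated by $U_l\otimes1$, $V_l\otimes 1$, $1\otimes U_r$, $1\otimes V_r$. The representation $\tilde\pi_T(a\otimes a')=\pi_T(a)\rho_T(a')$ of the algebraic tensor product $A\otimes_{\mathrm{alg}}A'$ on $K_T$ restricts to $A^{\mathrm{fin}}$ and extends continuously to a representation, again denoted $\tilde\pi_T$, of $A_\theta^{(2)}$ on $K_T$. Let $\psi_T$ be the state $\psi_T(x)=\langle\xi_T1,\tilde\pi_T(x)\xi_T1\rangle$ of $A_\theta^{(2)}$, where $1\in A_\theta\subseteq H_\tau$. Proposition 123.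 For all $T,S\in CP(A)$ the following are equivalent: (i) $T$ and $S$ are KSGNS-equivalent; (ii) the GNS representations of $A_\theta^{(2)}$ obtained from the states $\psi_T$ and $\psi_S$ are unitarily equivalent; (iii) the representations $\tilde\pi_T$ and $\tilde\pi_S$ of $A_\theta^{(2)}$ are unitarily equivalent; (iv) the representations $\tilde\pi_T$ and $\tilde\pi_S$ of $A\otimes_{\mathrm{alg}}A'$ are unitarily equivalent. -/

import Mathlib

open scoped InnerProductSpace TensorProduct ComplexOrder CStarAlgebra
open ContinuousLinearMap

/-- A norm closed `*`-algebra of operators, ordered as a subset of `B(H)`, is a star ordered ring: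
the positive elements are exactly the `star y * y`. -/
instance StarSubalgebra.instStarOrderedRingOfIsClosed
    {H : Type*} [NormedAddCommGroup H] [InnerProductSpace ℂ H] [CompleteSpace H]
    (S : StarSubalgebra ℂ (H →L[ℂ] H)) [hS : IsClosed (S : Set (H →L[ℂ] H))] :
    StarOrderedRing S := by
  refine StarOrderedRing.of_nonneg_iff' (fun {x y} h z => ?_) (fun x => ⟨fun hx => ?_, ?_⟩)
  · have h' : (x : H →L[ℂ] H) ≤ y := h
    exact add_le_add_right h' (z : H →L[ℂ] H)
  · have hx' : (0 : H →L[ℂ] H) ≤ x := hx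
    let o := CStarAlgebra.spectralOrder S
    have := CStarAlgebra.spectralOrderedRing S
    have hsa : IsSelfAdjoint x := Subtype.ext (IsSelfAdjoint.of_nonneg hx').star_eq
    have hsp' : SpectrumRestricts x ContinuousMap.realToNNReal := by
      rw [SpectrumRestricts.nnreal_iff]
      intro r hr
      refine spectrum_nonneg_of_nonneg hx' ?_
      rw [← spectrum.preimage_algebraMap ℂ] at hr ⊢
      have := StarSubalgebra.spectrum_eq S (a := x) (hS := hS)
      rw [this] at hr
      exact hr
    have h0 : @LE.le S o.toLE 0 x := by
      refine ⟨by simpa using hsa, ?_⟩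
      simpa using hsp'
    obtain ⟨y, hy⟩ := CStarAlgebra.nonneg_iff_eq_star_mul_self.mp h0
    exact ⟨y, hy⟩
  · rintro ⟨y, rfl⟩
    exact star_mul_self_nonneg (y : H →L[ℂ] H)

namespace CPMaps

section KSGNS

variable {H : Type*} [NormedAddCommGroup H] [InnerProductSpace ℂ H] [CompleteSpace H]

instance isClosed_vonNeumannAlgebra (M : VonNeumannAlgebra H) :
    IsClosed (M.toStarSubalgebra : Set (H →L[ℂ] H)) := by
  rw [VonNeumannAlgebra.coe_toStarSubalgebra, ← M.centralizer_centralizer]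
  exact Set.isClosed_centralizer _

/-- The elements of a von Neumann algebra, as a (partially ordered) C⋆-algebra. -/
abbrev Elem (M : VonNeumannAlgebra H) : Type _ := M.toStarSubalgebra

variable (M : VonNeumannAlgebra H)

theorem commute_of_mem_commutant (a : Elem M) (c : Elem M.commutant) (h : H) :
    (a : H →L[ℂ] H) ((c : H →L[ℂ] H) h) = (c : H →L[ℂ] H) ((a : H →L[ℂ] H) h) := by
  have hc : (c : H →L[ℂ] H) ∈ M.commutant := c.2
  have := VonNeumannAlgebra.mem_commutant_iff.mp hc a a.2
  exact congrArg (fun X : H →L[ℂ] H => X h) this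

variable {M}

theorem mem_of_commute {X : H →L[ℂ] H} (hX : ∀ g ∈ M.commutant, g * X = X * g) : X ∈ M := by
  rw [← M.commutant_commutant]
  exact VonNeumannAlgebra.mem_commutant_iff.mpr hX

/-- The ultraweakly continuous (normal) linear functionals on `M ⊆ B(H)`:
those of the form `a ↦ ∑ₙ ⟨xₙ, a yₙ⟩` with `∑ₙ ‖xₙ‖² < ∞` and `∑ₙ ‖yₙ‖² < ∞`. -/
def IsNormalFunctional (φ : Elem M → ℂ) : Prop :=
  ∃ x y : ℕ → H, Summable (fun n => ‖x n‖ ^ 2) ∧ Summable (fun n => ‖y n‖ ^ 2) ∧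
    ∀ a : Elem M, HasSum (fun n => ⟪x n, (a : H →L[ℂ] H) (y n)⟫_ℂ) (φ a)

/-- A map `M → M` is normal if it is ultraweakly continuous: it pulls normal functionals
back to normal functionals. -/
def IsNormalMap (T : Elem M → Elem M) : Prop :=
  ∀ φ : Elem M → ℂ, IsNormalFunctional φ → IsNormalFunctional (fun a => φ (T a))

variable (M) in
/-- `CP(M)`: the normal unital completely positive maps on the von Neumann algebra `M`. -/
structure NormalUCP where
  /-- the underlying completely positive map -/
  toCP : Elem M →CP Elem M
  map_one : toCP 1 = 1
  normal : IsNormalMap (fun a => toCP a)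

/-- `T a` as an operator on `H`. -/
noncomputable def NormalUCP.op (T : NormalUCP M) (a : Elem M) : H →L[ℂ] H := (T.toCP a : H →L[ℂ] H)

theorem NormalUCP.op_add (T : NormalUCP M) (a b : Elem M) : T.op (a + b) = T.op a + T.op b := by
  simp [NormalUCP.op]

theorem NormalUCP.op_smul (T : NormalUCP M) (c : ℂ) (a : Elem M) : T.op (c • a) = c • T.op a := by
  simp [NormalUCP.op]

theorem NormalUCP.op_one (T : NormalUCP M) : T.op 1 = 1 := by
  simp [NormalUCP.op, T.map_one]

theorem NormalUCP.op_star (T : NormalUCP M) (a : Elem M) : T.op (star a) = star (T.op a) := by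
  have : T.toCP (star a) = star (T.toCP a) := map_star T.toCP a
  simp [NormalUCP.op, this]

/-- A positive matrix over `M` defines a positive form on tuples of vectors. -/
theorem matrix_form_nonneg {n : ℕ} {Y : CStarMatrix (Fin n) (Fin n) (Elem M)} (hY : 0 ≤ Y)
    (h : Fin n → H) : 0 ≤ ∑ i, ∑ j, ⟪h i, (Y i j : H →L[ℂ] H) (h j)⟫_ℂ := by
  rw [StarOrderedRing.nonneg_iff] at hY
  induction hY using AddSubmonoid.closure_induction with
  | zero => simp
  | add Y Z _ _ h1 h2 =>
    have := add_nonneg h1 h2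
    simpa [inner_add_right, Finset.sum_add_distrib] using this
  | mem Y hY =>
    obtain ⟨N, rfl⟩ := hY
    have : ∑ i, ∑ j, ⟪h i, ((star N * N) i j : H →L[ℂ] H) (h j)⟫_ℂ =
        ∑ k, ⟪∑ i, (N k i : H →L[ℂ] H) (h i), ∑ j, (N k j : H →L[ℂ] H) (h j)⟫_ℂ := by
      have e : ∀ i j, ⟪h i, ((star N * N) i j : H →L[ℂ] H) (h j)⟫_ℂ =
          ∑ k, ⟪(N k i : H →L[ℂ] H) (h i), (N k j : H →L[ℂ] H) (h j)⟫_ℂ := by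
        intro i j
        have h1 : (star N * N) i j = ∑ k, star (N k i) * N k j := by
          simp [CStarMatrix.mul_apply, CStarMatrix.star_apply]
        rw [h1]
        simp [sum_apply, star_eq_adjoint, adjoint_inner_right]
      simp only [e, inner_sum, sum_inner]
      calc _ = ∑ i, ∑ k, ∑ j, ⟪(N k i : H →L[ℂ] H) (h i), (N k j : H →L[ℂ] H) (h j)⟫_ℂ :=
            Finset.sum_congr rfl fun i _ => Finset.sum_comm
        _ = ∑ k, ∑ i, ∑ j, ⟪(N k i : H →L[ℂ] H) (h i), (N k j : H →L[ℂ] H) (h j)⟫_ℂ :=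
            Finset.sum_comm
        _ = _ := Finset.sum_congr rfl fun k _ => Finset.sum_comm
    rw [this]
    refine Finset.sum_nonneg fun k _ => ?_
    exact RCLike.nonneg_iff.mpr ⟨inner_self_nonneg, inner_self_im _⟩

/-- Complete positivity, in terms of vectors. -/
theorem NormalUCP.sum_nonneg (T : NormalUCP M) {n : ℕ} (a : Fin n → Elem M) (h : Fin n → H) :
    0 ≤ ∑ i, ∑ j, ⟪h i, T.op (star (a i) * a j) (h j)⟫_ℂ := by
  rcases n with _ | n
  · simp
  let X : CStarMatrix (Fin (n + 1)) (Fin (n + 1)) (Elem M) :=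
    CStarMatrix.ofMatrix (fun k j => if k = 0 then a j else 0)
  have hX : 0 ≤ star X * X := star_mul_self_nonneg X
  have hTX := matrix_form_nonneg (T.toCP.map_cstarMatrix_nonneg _ hX) h
  have key : ∀ i j, (star X * X) i j = star (a i) * a j := by
    intro i j
    have hX' : ∀ k l, X k l = if k = 0 then a l else 0 := fun _ _ => rfl
    simp only [CStarMatrix.mul_apply, CStarMatrix.star_apply, hX']
    rw [Finset.sum_eq_single 0]
    · simp
    · intro k _ hk; simp [hk]
    · simp
  simp only [CStarMatrix.map_apply, key] at hTX
  exact hTX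

/-- The algebraic tensor product `M ⊗ H`, as the domain of the Stinespring form of `T`. -/
def PreStinespring (_T : NormalUCP M) : Type _ := Elem M ⊗[ℂ] H

namespace PreStinespring

variable (T : NormalUCP M)

noncomputable instance : AddCommGroup (PreStinespring T) :=
  inferInstanceAs (AddCommGroup (Elem M ⊗[ℂ] H))

noncomputable instance : Module ℂ (PreStinespring T) :=
  inferInstanceAs (Module ℂ (Elem M ⊗[ℂ] H))

/-- The elementary tensor `a ⊗ h`. -/
noncomputable def tmul (a : Elem M) (h : H) : PreStinespring T := a ⊗ₜ[ℂ] h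

/-- The linear functional `b ⊗ k ↦ ⟨h, T (a⋆ b) k⟩`. -/
noncomputable def formAux (a : Elem M) (h : H) : PreStinespring T →ₗ[ℂ] ℂ :=
  TensorProduct.lift (LinearMap.mk₂ ℂ (fun (b : Elem M) (k : H) => ⟪h, T.op (star a * b) k⟫_ℂ)
    (fun b b' k => by simp [mul_add, T.op_add])
    (fun c b k => by simp [T.op_smul])
    (fun b k k' => by simp)
    (fun c b k => by simp))

/-- The sesquilinear form determined by `⟨a ⊗ h, b ⊗ k⟩ = ⟨h, T (a⋆ b) k⟩`. -/
noncomputable def form : PreStinespring T →ₗ⋆[ℂ] PreStinespring T →ₗ[ℂ] ℂ :=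
  TensorProduct.lift (LinearMap.mk₂'ₛₗ (starRingEnd ℂ) (starRingEnd ℂ)
    (fun (a : Elem M) (h : H) => formAux T a h)
    (fun a a' h => TensorProduct.ext' fun b k => by
      change ⟪h, T.op (star (a + a') * b) k⟫_ℂ =
        ⟪h, T.op (star a * b) k⟫_ℂ + ⟪h, T.op (star a' * b) k⟫_ℂ
      simp [add_mul, T.op_add])
    (fun c a h => TensorProduct.ext' fun b k => by
      change ⟪h, T.op (star (c • a) * b) k⟫_ℂ = (starRingEnd ℂ c) * ⟪h, T.op (star a * b) k⟫_ℂ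
      simp [T.op_smul])
    (fun a h h' => TensorProduct.ext' fun b k => by
      change ⟪h + h', T.op (star a * b) k⟫_ℂ =
        ⟪h, T.op (star a * b) k⟫_ℂ + ⟪h', T.op (star a * b) k⟫_ℂ
      simp)
    (fun c a h => TensorProduct.ext' fun b k => by
      change ⟪c • h, T.op (star a * b) k⟫_ℂ = (starRingEnd ℂ c) * ⟪h, T.op (star a * b) k⟫_ℂ
      simp [mul_comm]))

theorem form_tmul (a b : Elem M) (h k : H) :
    form T (tmul T a h) (tmul T b k) = ⟪h, T.op (star a * b) k⟫_ℂ := rfl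

variable {T} in
theorem induction {p : PreStinespring T → Prop} (x : PreStinespring T) (zero : p 0)
    (tmul : ∀ a h, p (tmul T a h)) (add : ∀ x y, p x → p y → p (x + y)) : p x :=
  TensorProduct.induction_on x zero tmul add

theorem exists_sum (x : PreStinespring T) :
    ∃ (n : ℕ) (a : Fin n → Elem M) (h : Fin n → H), x = ∑ i, tmul T (a i) (h i) := by
  induction x using PreStinespring.induction with
  | zero => exact ⟨0, Fin.elim0, Fin.elim0, by simp⟩
  | tmul a h => exact ⟨1, fun _ => a, fun _ => h, by simp⟩
  | add x y hx hy =>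
    obtain ⟨n, a, h, rfl⟩ := hx
    obtain ⟨m, b, k, rfl⟩ := hy
    exact ⟨n + m, Fin.append a b, Fin.append h k, by simp [Fin.sum_univ_add]⟩

theorem form_self_nonneg (x : PreStinespring T) : 0 ≤ form T x x := by
  obtain ⟨n, a, h, rfl⟩ := exists_sum T x
  simp only [map_sum, LinearMap.sum_apply, form_tmul]
  rw [Finset.sum_comm]
  exact T.sum_nonneg a h

theorem form_conj_symm (x y : PreStinespring T) : star (form T y x) = form T x y := by
  induction x using PreStinespring.induction with
  | zero => simp
  | add x x' hx hx' => simp [← hx, ← hx']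
  | tmul a h =>
    induction y using PreStinespring.induction with
    | zero => simp
    | add y y' hy hy' => simp [← hy, ← hy']
    | tmul b k =>
      have : star a * b = star (star b * a) := by simp
      rw [form_tmul, form_tmul, this, T.op_star, star_eq_adjoint, adjoint_inner_right]
      simp

/-- The semi-inner product on `M ⊗ H`. -/
noncomputable abbrev core : PreInnerProductSpace.Core ℂ (PreStinespring T) where
  inner x y := form T x y
  conj_inner_symm x y := form_conj_symm T x y
  re_inner_nonneg x := (RCLike.nonneg_iff.mp (form_self_nonneg T x)).1
  add_left x y z := by simp
  smul_left x y c := by simp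

noncomputable instance : SeminormedAddCommGroup (PreStinespring T) :=
  InnerProductSpace.Core.toSeminormedAddCommGroup (c := core T)

noncomputable instance : InnerProductSpace ℂ (PreStinespring T) :=
  InnerProductSpace.ofCore (core T)

theorem inner_tmul (a b : Elem M) (h k : H) :
    ⟪tmul T a h, tmul T b k⟫_ℂ = ⟪h, T.op (star a * b) k⟫_ℂ := rfl

theorem tmul_add (a : Elem M) (h k : H) : tmul T a (h + k) = tmul T a h + tmul T a k :=
  TensorProduct.tmul_add a h k

theorem tmul_smul (c : ℂ) (a : Elem M) (h : H) : tmul T a (c • h) = c • tmul T a h :=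
  TensorProduct.tmul_smul c a h

end PreStinespring


end KSGNS
/-! ### Representations on the completion of a semi-inner product space -/

section CompletionRep

variable {B : Type*} [CStarAlgebra B]
  {P : Type*} [SeminormedAddCommGroup P] [InnerProductSpace ℂ P]
  (φ : B →ₐ[ℂ] Module.End ℂ P) (hφ : ∀ b x y, ⟪φ b x, y⟫_ℂ = ⟪x, φ (star b) y⟫_ℂ)

theorem norm_action_le {B : Type*} [CStarAlgebra B]
    {P : Type*} [SeminormedAddCommGroup P] [InnerProductSpace ℂ P]
    (φ : B →ₐ[ℂ] Module.End ℂ P) (hφ : ∀ b x y, ⟪φ b x, y⟫_ℂ = ⟪x, φ (star b) y⟫_ℂ) (b : B) (x : P) : ‖φ b x‖ ≤ ‖b‖ * ‖x‖ := by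
  let _ := CStarAlgebra.spectralOrder B
  have := CStarAlgebra.spectralOrderedRing B
  have h0 : 0 ≤ algebraMap ℝ B (‖b‖ ^ 2) - star b * b :=
    sub_nonneg.mpr CStarAlgebra.star_mul_le_algebraMap_norm_sq
  obtain ⟨d, hd⟩ := CStarAlgebra.nonneg_iff_eq_star_mul_self.mp h0
  have h1 : ∀ c : B, ⟪φ c x, φ c x⟫_ℂ = ⟪x, φ (star c * c) x⟫_ℂ := by
    intro c; rw [hφ, map_mul, Module.End.mul_apply]
  have h2 : star d * d = ((‖b‖ ^ 2 : ℝ) : ℂ) • (1 : B) - star b * b := by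
    rw [← hd, Algebra.algebraMap_eq_smul_one, Complex.coe_smul]
  have h3 : ⟪φ d x, φ d x⟫_ℂ = ((‖b‖ ^ 2 : ℝ) : ℂ) * ⟪x, x⟫_ℂ - ⟪φ b x, φ b x⟫_ℂ := by
    rw [h1, h1, h2, map_sub, map_smul, map_one, LinearMap.sub_apply, inner_sub_right,
      LinearMap.smul_apply, Module.End.one_apply, inner_smul_right]
  have e : ∀ z : P, (⟪z, z⟫_ℂ).re = ‖z‖ ^ 2 := fun z => inner_self_eq_norm_sq (𝕜 := ℂ) z
  have h4 : ‖φ d x‖ ^ 2 = ‖b‖ ^ 2 * ‖x‖ ^ 2 - ‖φ b x‖ ^ 2 := by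
    have := congrArg Complex.re h3
    rwa [Complex.sub_re, Complex.re_ofReal_mul, e, e, e] at this
  refine le_of_sq_le_sq ?_ (by positivity)
  nlinarith [sq_nonneg ‖φ d x‖]

/-- A `*`-action of a C⋆-algebra on a semi-inner product space, extended to the completion. -/
noncomputable def completionRep :
    B →⋆ₐ[ℂ] (UniformSpace.Completion P →L[ℂ] UniformSpace.Completion P) :=
  let F : B → (P →L[ℂ] P) := fun b => (φ b).mkContinuous ‖b‖ (norm_action_le φ hφ b)
  have hF : ∀ b x, F b x = φ b x := fun _ _ => rfl
  have hext : ∀ X Y : UniformSpace.Completion P →L[ℂ] UniformSpace.Completion P,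
      (∀ x : P, X x = Y x) → X = Y := fun X Y h => by
    ext z
    induction z using UniformSpace.Completion.induction_on with
    | hp => exact isClosed_eq X.continuous Y.continuous
    | ih x => exact h x
  { toFun := fun b => (F b).completion
    map_one' := hext _ _ fun x => by simp [hF]
    map_mul' := fun a b => hext _ _ fun x => by simp [hF]
    map_zero' := hext _ _ fun x => by
      simp [hF, UniformSpace.Completion.coe_zero]
    map_add' := fun a b => hext _ _ fun x => by
      simp [hF, UniformSpace.Completion.coe_add]
    commutes' := fun r => hext _ _ fun x => by
      simp [hF, Algebra.algebraMap_eq_smul_one, UniformSpace.Completion.coe_smul]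
    map_star' := fun a => by
      refine (eq_adjoint_iff _ _).mpr fun x y => ?_
      induction x, y using UniformSpace.Completion.induction_on₂ with
      | hp => exact isClosed_eq (by fun_prop) (by fun_prop)
      | ih x y => simp [hF, hφ] }

theorem completionRep_coe (b : B) (x : P) :
    completionRep φ hφ b (x : UniformSpace.Completion P) = (φ b x : P) := by
  change (ContinuousLinearMap.completion _) _ = _
  rw [ContinuousLinearMap.completion_apply_coe]
  rfl

end CompletionRep

section KSGNS2
variable {H : Type*} [NormedAddCommGroup H] [InnerProductSpace ℂ H] [CompleteSpace H]
variable {M : VonNeumannAlgebra H}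
namespace NormalUCP
variable (T : NormalUCP M)

/-- The Stinespring space `K_T`: the Hilbert space completion of `M ⊗ H` in the form
`⟨a ⊗ h, b ⊗ k⟩ = ⟨h, T (a⋆ b) k⟩`. -/
abbrev Space : Type _ := UniformSpace.Completion (PreStinespring T)

/-- The class of `a ⊗ h` in `K_T`. -/
noncomputable def tmul (a : Elem M) (h : H) : T.Space :=
  ((PreStinespring.tmul T a h : PreStinespring T) : T.Space)

theorem inner_tmul (a b : Elem M) (h k : H) :
    ⟪T.tmul a h, T.tmul b k⟫_ℂ = ⟪h, T.op (star a * b) k⟫_ℂ := by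
  rw [tmul, tmul, UniformSpace.Completion.inner_coe, PreStinespring.inner_tmul]

/-- The action of `M` on `M ⊗ H` by multiplication on the left: `a · (b ⊗ k) = a b ⊗ k`. -/
noncomputable def leftAction : Elem M →ₐ[ℂ] Module.End ℂ (PreStinespring T) :=
  (Module.End.rTensorAlgHom ℂ (Elem M) H).comp (Algebra.lmul ℂ (Elem M))

theorem leftAction_tmul (a b : Elem M) (k : H) :
    T.leftAction a (PreStinespring.tmul T b k) = PreStinespring.tmul T (a * b) k := rfl

/-- The action of the commutant of `M` on `M ⊗ H`: `c · (b ⊗ k) = b ⊗ c k`. -/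
noncomputable def rightAction : Elem M.commutant →ₐ[ℂ] Module.End ℂ (PreStinespring T) :=
  (Module.End.lTensorAlgHom ℂ H (Elem M)).comp
    { toFun := fun c => ((c : H →L[ℂ] H) : H →ₗ[ℂ] H)
      map_one' := rfl
      map_mul' := fun _ _ => rfl
      map_zero' := rfl
      map_add' := fun _ _ => rfl
      commutes' := fun _ => rfl }

theorem rightAction_tmul (c : Elem M.commutant) (b : Elem M) (k : H) :
    T.rightAction c (PreStinespring.tmul T b k) =
      PreStinespring.tmul T b ((c : H →L[ℂ] H) k) := rfl

theorem leftAction_inner (a : Elem M) (x y : PreStinespring T) :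
    ⟪T.leftAction a x, y⟫_ℂ = ⟪x, T.leftAction (star a) y⟫_ℂ := by
  induction x using PreStinespring.induction with
  | zero => simp
  | add x x' hx hx' => rw [map_add, inner_add_left, inner_add_left, hx, hx']
  | tmul b h =>
    induction y using PreStinespring.induction with
    | zero => simp
    | add y y' hy hy' => rw [map_add, inner_add_right, inner_add_right, hy, hy']
    | tmul c k =>
      rw [leftAction_tmul, leftAction_tmul, PreStinespring.inner_tmul, PreStinespring.inner_tmul,
        star_mul, mul_assoc]

theorem rightAction_inner (c : Elem M.commutant) (x y : PreStinespring T) :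
    ⟪T.rightAction c x, y⟫_ℂ = ⟪x, T.rightAction (star c) y⟫_ℂ := by
  induction x using PreStinespring.induction with
  | zero => simp
  | add x x' hx hx' => rw [map_add, inner_add_left, inner_add_left, hx, hx']
  | tmul b h =>
    induction y using PreStinespring.induction with
    | zero => simp
    | add y y' hy hy' => rw [map_add, inner_add_right, inner_add_right, hy, hy']
    | tmul d k =>
      rw [rightAction_tmul, rightAction_tmul, PreStinespring.inner_tmul,
        PreStinespring.inner_tmul, NormalUCP.op, commute_of_mem_commutant]
      simp [star_eq_adjoint, adjoint_inner_right]

/-- The Stinespring representation `π_T` of `M` on `K_T`: `π_T(a) (b ⊗ k) = a b ⊗ k`. -/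
noncomputable def pi : Elem M →⋆ₐ[ℂ] (T.Space →L[ℂ] T.Space) :=
  completionRep T.leftAction T.leftAction_inner

/-- The representation `ρ_T` of the commutant on `K_T`: `ρ_T(c) (b ⊗ k) = b ⊗ c k`. -/
noncomputable def rho : Elem M.commutant →⋆ₐ[ℂ] (T.Space →L[ℂ] T.Space) :=
  completionRep T.rightAction T.rightAction_inner

theorem pi_tmul (a b : Elem M) (k : H) : T.pi a (T.tmul b k) = T.tmul (a * b) k := by
  rw [pi, tmul, completionRep_coe, leftAction_tmul, tmul]

theorem rho_tmul (c : Elem M.commutant) (b : Elem M) (k : H) :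
    T.rho c (T.tmul b k) = T.tmul b ((c : H →L[ℂ] H) k) := by
  rw [rho, tmul, completionRep_coe, rightAction_tmul, tmul]

/-- Operators on `K_T` that agree on the vectors `a ⊗ h` are equal. -/
theorem ext_tmul {F : Type*} [NormedAddCommGroup F] [NormedSpace ℂ F] {X Y : T.Space →L[ℂ] F}
    (h : ∀ a k, X (T.tmul a k) = Y (T.tmul a k)) : X = Y := by
  ext z
  induction z using UniformSpace.Completion.induction_on with
  | hp => exact isClosed_eq X.continuous Y.continuous
  | ih x =>
    induction x using PreStinespring.induction with
    | zero => simp [UniformSpace.Completion.coe_zero]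
    | add x y hx hy => simp [UniformSpace.Completion.coe_add, hx, hy]
    | tmul a k => exact h a k

theorem pi_rho_commute (a : Elem M) (c : Elem M.commutant) : Commute (T.pi a) (T.rho c) := by
  refine T.ext_tmul fun b k => ?_
  simp [pi_tmul, rho_tmul]

/-- The isometry `ξ_T : H → K_T`, `ξ_T h = 1 ⊗ h`, so that `ξ_T⋆ π_T(a) ξ_T = T a`. -/
noncomputable def xi : H →L[ℂ] T.Space :=
  LinearMap.mkContinuous
    { toFun := fun h => T.tmul 1 h
      map_add' := fun h k => by
        simp [tmul, PreStinespring.tmul_add, UniformSpace.Completion.coe_add]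
      map_smul' := fun c h => by
        simp [tmul, PreStinespring.tmul_smul, UniformSpace.Completion.coe_smul] } 1
    fun h => by
      have e : ‖T.tmul 1 h‖ ^ 2 = ‖h‖ ^ 2 := by
        have e : ⟪T.tmul 1 h, T.tmul 1 h⟫_ℂ = ⟪h, h⟫_ℂ := by
          rw [T.inner_tmul, star_one, one_mul, T.op_one, one_apply_eq_self]
        have e' := congrArg Complex.re e
        have e1 := inner_self_eq_norm_sq (𝕜 := ℂ) (T.tmul 1 h)
        have e2 := inner_self_eq_norm_sq (𝕜 := ℂ) h
        rw [← e1, ← e2]; exact e'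
      rw [one_mul]
      exact le_of_sq_le_sq e.le (norm_nonneg h)

theorem xi_apply (h : H) : T.xi h = T.tmul 1 h := rfl

theorem adjoint_xi_pi_xi (a : Elem M) : adjoint T.xi ∘L T.pi a ∘L T.xi = T.op a := by
  ext h
  refine ext_inner_left ℂ fun k => ?_
  simp [adjoint_inner_right, xi_apply, pi_tmul, T.inner_tmul]

/-! ### The KSGNS bimodule -/

/-- The linear span of the operators `π_T(a) ξ_T b`, `a, b ∈ M`. -/
noncomputable def algBimodule : Submodule ℂ (H →L[ℂ] T.Space) :=
  Submodule.span ℂ {R | ∃ a b : Elem M, R = T.pi a ∘L T.xi ∘L (b : H →L[ℂ] H)}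

/-- The KSGNS bimodule `E_T ⊆ B(H, K_T)`: the closure of the span of `π_T(M) ξ_T M` in the
strong operator topology (the topology of pointwise convergence on `H`). -/
noncomputable def bimodule : Submodule ℂ (H →L[ℂ] T.Space) :=
  let ev : (H →L[ℂ] T.Space) →ₗ[ℂ] (H → T.Space) :=
    { toFun := fun R => R, map_add' := fun _ _ => rfl, map_smul' := fun _ _ => rfl }
  ((T.algBimodule.map ev).topologicalClosure).comap ev

theorem mem_bimodule {R : H →L[ℂ] T.Space} : R ∈ T.bimodule ↔
    (R : H → T.Space) ∈
      closure ((fun X : H →L[ℂ] T.Space => (X : H → T.Space)) '' T.algBimodule) := Iff.rfl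


theorem algBimodule_le : T.algBimodule ≤ T.bimodule := fun R hR =>
  T.mem_bimodule.mpr (subset_closure ⟨R, hR, rfl⟩)

/-- A linear operation on `B(H, K_T)` that is pointwise continuous and preserves the span of
`π_T(M) ξ_T M` preserves the bimodule. -/
theorem bimodule_map (L : (H →L[ℂ] T.Space) → (H →L[ℂ] T.Space))
    (f : (H → T.Space) → (H → T.Space)) (hf : Continuous f)
    (hL : ∀ X : H →L[ℂ] T.Space, (L X : H → T.Space) = f X)
    (hs : ∀ X ∈ T.algBimodule, L X ∈ T.algBimodule) {R : H →L[ℂ] T.Space} (hR : R ∈ T.bimodule) :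
    L R ∈ T.bimodule := by
  rw [mem_bimodule] at hR ⊢
  rw [hL]
  refine map_mem_closure hf hR ?_
  rintro _ ⟨X, hX, rfl⟩
  exact ⟨L X, hs X hX, hL X⟩

theorem pi_comp_mem (a : Elem M) {R : H →L[ℂ] T.Space} (hR : R ∈ T.bimodule) :
    T.pi a ∘L R ∈ T.bimodule := by
  refine T.bimodule_map (fun X => T.pi a ∘L X) (fun g h => T.pi a (g h))
    (continuous_pi fun h => (T.pi a).continuous.comp (continuous_apply h))
    (fun _ => rfl) (fun X hX => ?_) hR
  induction hX using Submodule.span_induction with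
  | zero => simp
  | add X Y _ _ hX hY => rw [comp_add]; exact add_mem hX hY
  | smul c X _ hX => rw [comp_smul]; exact Submodule.smul_mem _ c hX
  | mem X hX =>
    obtain ⟨b, d, rfl⟩ := hX
    refine Submodule.subset_span ⟨a * b, d, ?_⟩
    rw [map_mul]; rfl

theorem comp_mem (b : Elem M) {R : H →L[ℂ] T.Space} (hR : R ∈ T.bimodule) :
    R ∘L (b : H →L[ℂ] H) ∈ T.bimodule := by
  refine T.bimodule_map (fun X => X ∘L (b : H →L[ℂ] H)) (fun g h => g ((b : H →L[ℂ] H) h))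
    (continuous_pi fun h => continuous_apply _) (fun _ => rfl) (fun X hX => ?_) hR
  induction hX using Submodule.span_induction with
  | zero => simp
  | add X Y _ _ hX hY => rw [add_comp]; exact add_mem hX hY
  | smul c X _ hX => rw [smul_comp]; exact Submodule.smul_mem _ c hX
  | mem X hX =>
    obtain ⟨a, d, rfl⟩ := hX
    exact Submodule.subset_span ⟨a, d * b, rfl⟩

/-- Elements of the bimodule intertwine the commutant with `ρ_T`. -/
theorem rho_bimodule (c : Elem M.commutant) {R : H →L[ℂ] T.Space} (hR : R ∈ T.bimodule) (h : H) :
    R ((c : H →L[ℂ] H) h) = T.rho c (R h) := by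
  have hcl : IsClosed {g : H → T.Space | g ((c : H →L[ℂ] H) h) = T.rho c (g h)} :=
    isClosed_eq (continuous_apply _) ((T.rho c).continuous.comp (continuous_apply h))
  refine closure_minimal ?_ hcl (T.mem_bimodule.mp hR)
  rintro _ ⟨X, hX, rfl⟩
  change X ((c : H →L[ℂ] H) h) = T.rho c (X h)
  induction hX using Submodule.span_induction with
  | zero => simp
  | add X Y _ _ hX hY => simp [hX, hY]
  | smul z X _ hX => simp [hX]
  | mem X hX =>
    obtain ⟨a, b, rfl⟩ := hX
    simp [xi_apply, pi_tmul, rho_tmul, commute_of_mem_commutant]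

/-- The left action of `M` on `E_T`: `a · R = π_T(a) R`. -/
noncomputable def leftMul (a : Elem M) (R : T.bimodule) : T.bimodule :=
  ⟨T.pi a ∘L (R : H →L[ℂ] T.Space), T.pi_comp_mem a R.2⟩

/-- The right action of `M` on `E_T`: `R · b = R b`. -/
noncomputable def rightMul (R : T.bimodule) (b : Elem M) : T.bimodule :=
  ⟨(R : H →L[ℂ] T.Space) ∘L (b : H →L[ℂ] H), T.comp_mem b R.2⟩

/-- The `M`-valued inner product `⟨R, S⟩ = R⋆ S` on `E_T`. -/
noncomputable def innerMod (R S : T.bimodule) : Elem M :=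
  ⟨adjoint (R : H →L[ℂ] T.Space) ∘L (S : H →L[ℂ] T.Space), by
    refine mem_of_commute fun g hg => ?_
    ext h
    refine ext_inner_left ℂ fun k => ?_
    have h1 := T.rho_bimodule ⟨g, hg⟩ S.2 h
    have h2 := T.rho_bimodule (star ⟨g, hg⟩) R.2 k
    simp only [map_star] at h2
    have h2' : (R : H →L[ℂ] T.Space) (adjoint g k) =
        adjoint (T.rho ⟨g, hg⟩) ((R : H →L[ℂ] T.Space) k) := h2
    simp only [mul_apply_eq_comp, comp_apply, adjoint_inner_right]
    rw [← adjoint_inner_left, adjoint_inner_right, h2', adjoint_inner_left]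
    exact congrArg _ h1.symm⟩

/-- `T` and `S` are KSGNS-equivalent: the bimodules `E_T` and `E_S` are isomorphic, i.e. there is
a linear bijection that preserves the `M`-valued inner products and intertwines the left and the
right actions of `M`. -/
def KSGNSEquivalent (T S : NormalUCP M) : Prop :=
  ∃ Φ : T.bimodule ≃ₗ[ℂ] S.bimodule,
    (∀ Q R, S.innerMod (Φ Q) (Φ R) = T.innerMod Q R) ∧
    (∀ a R, Φ (T.leftMul a R) = S.leftMul a (Φ R)) ∧
    (∀ R b, Φ (T.rightMul R b) = S.rightMul (Φ R) b)

/-- The representation `π̃_T` of the algebraic tensor product of `M` and its commutant on `K_T`: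
`π̃_T(a ⊗ c) = π_T(a) ρ_T(c)`. -/
noncomputable def piTildeAlg : Elem M ⊗[ℂ] Elem M.commutant →⋆ₐ[ℂ] (T.Space →L[ℂ] T.Space) :=
  { Algebra.TensorProduct.lift (T.pi : Elem M →ₐ[ℂ] (T.Space →L[ℂ] T.Space))
      (T.rho : Elem M.commutant →ₐ[ℂ] (T.Space →L[ℂ] T.Space)) T.pi_rho_commute with
    map_star' := fun x => by
      change Algebra.TensorProduct.lift _ _ _ _ = star (Algebra.TensorProduct.lift _ _ _ _)
      induction x using TensorProduct.induction_on with
      | zero => simp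
      | add x y hx hy => rw [star_add, map_add, hx, hy, map_add, star_add]
      | tmul a c =>
        simp only [TensorProduct.star_tmul, Algebra.TensorProduct.lift_tmul]
        simp only [StarAlgHom.coe_toAlgHom, map_star]
        rw [← star_mul, (T.pi_rho_commute a c).eq] }

theorem piTildeAlg_tmul (a : Elem M) (c : Elem M.commutant) :
    T.piTildeAlg (a ⊗ₜ c) = T.pi a * T.rho c := rfl

end NormalUCP
end KSGNS2

/-! ### Weighted shifts on `ℓ²(G)` -/

section Shift

variable {G : Type*} [AddCommGroup G]

/-- The unit vector `δ_g` of `ℓ²(G)`. -/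
noncomputable def delta [DecidableEq G] (g : G) : lp (fun _ : G => ℂ) 2 := lp.single 2 g 1

theorem memℓp_shift (v : G) (w : G → Circle) (f : lp (fun _ : G => ℂ) 2) :
    Memℓp (fun i => (w i : ℂ) * f (i + v)) 2 := by
  have := lp.memℓp f
  rw [memℓp_gen_iff (by norm_num)] at this ⊢
  refine ((Equiv.addRight v).summable_iff.mpr this).congr fun i => ?_
  rw [norm_mul, Circle.norm_coe, one_mul]
  rfl

/-- The weighted shift `(S f)(i) = w (i - v) f (i - v)` on `ℓ²(G)`, that is,
`S δ_j = w j δ_{v + j}`; it is unitary because the weights have modulus one. -/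
noncomputable def shiftIso (v : G) (w : G → Circle) :
    lp (fun _ : G => ℂ) 2 ≃ₗᵢ[ℂ] lp (fun _ : G => ℂ) 2 where
  toFun f := ⟨fun i => (w (i - v) : ℂ) * f (i - v), by
    have := memℓp_shift (-v) (fun i => w (i - v)) f
    simp only [← sub_eq_add_neg] at this
    exact this⟩
  invFun f := ⟨fun i => (((w i)⁻¹ : Circle) : ℂ) * f (i + v), memℓp_shift v (fun i => (w i)⁻¹) f⟩
  map_add' f g := by
    ext i
    exact mul_add _ _ _
  map_smul' c f := by
    ext i
    exact mul_left_comm _ _ _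
  left_inv f := by
    ext i
    change (((w i)⁻¹ : Circle) : ℂ) * ((w (i + v - v) : ℂ) * f (i + v - v)) = f i
    simp
  right_inv f := by
    ext i
    change (w (i - v) : ℂ) * ((((w (i - v))⁻¹ : Circle) : ℂ) * f (i - v + v)) = f i
    simp
  norm_map' f := by
    rw [lp.norm_eq_tsum_rpow (by norm_num), lp.norm_eq_tsum_rpow (by norm_num)]
    congr 1
    refine Eq.trans ?_ ((Equiv.subRight v).tsum_eq (fun i => ‖f i‖ ^ (2 : ENNReal).toReal))
    refine tsum_congr fun i => ?_
    change ‖(w (i - v) : ℂ) * f (i - v)‖ ^ _ = _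
    rw [norm_mul, Circle.norm_coe, one_mul]
    rfl

/-- The weighted shift as a bounded operator. -/
noncomputable def shift (v : G) (w : G → Circle) :
    lp (fun _ : G => ℂ) 2 →L[ℂ] lp (fun _ : G => ℂ) 2 :=
  (shiftIso v w).toContinuousLinearEquiv

theorem shift_apply (v : G) (w : G → Circle) (f : lp (fun _ : G => ℂ) 2) (i : G) :
    shift v w f i = (w (i - v) : ℂ) * f (i - v) := rfl

theorem shift_delta [DecidableEq G] (v : G) (w : G → Circle) (j : G) :
    shift v w (delta j) = (w j : ℂ) • delta (v + j) := by
  ext i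
  rw [shift_apply, lp.coeFn_smul, Pi.smul_apply, delta, delta, lp.single_apply, lp.single_apply]
  by_cases h : i = v + j
  · subst h; simp
  · have h' : i - v ≠ j := fun h'' => h (by rw [← h'']; abel)
    simp [h, h']

theorem shift_mem_unitary (v : G) (w : G → Circle) :
    shift v w ∈ unitary (lp (fun _ : G => ℂ) 2 →L[ℂ] lp (fun _ : G => ℂ) 2) := by
  have h1 : star (shift v w) * shift v w = 1 := by
    rw [star_eq_adjoint]
    exact (ContinuousLinearMap.norm_map_iff_adjoint_comp_self _).mp (shiftIso v w).norm_map
  refine Unitary.mem_iff.mpr ⟨h1, ?_⟩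
  have h2 : shift v w * ((shiftIso v w).symm.toContinuousLinearEquiv : _ →L[ℂ] _) = 1 := by
    ext1 f
    exact (shiftIso v w).apply_symm_apply f
  have h3 := left_inv_eq_right_inv h1 h2
  rw [h3, h2]

theorem shift_mul (v v' : G) (w w' : G → Circle) :
    shift v w * shift v' w' = shift (v + v') (fun j => w (v' + j) * w' j) := by
  ext f i
  simp only [mul_apply_eq_comp, shift_apply, Circle.coe_mul]
  rw [show i - v - v' = i - (v + v') by abel, show v' + (i - (v + v')) = i - v by abel, mul_assoc]

end Shift

/-! ### The hyperfinite `II₁` factor and the second order rotation algebra -/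

section Rotation

open Complex

/-- `λ = exp(2πiθ)`. -/
noncomputable def lam (θ : ℝ) : Circle := Circle.exp (2 * Real.pi * θ)

/-- The Hilbert space `H_τ = L²(A_θ, τ)` of the canonical trace of the irrational rotation algebra
`A_θ = C⋆(U, V)`, `U V = λ V U`, realized as `ℓ²(ℤ²)` through its orthonormal basis
`U^m V^n = δ_(m,n)`. -/
abbrev Hτ : Type := lp (fun _ : ℤ × ℤ => ℂ) 2

/-- The Hilbert space `H_τ ⊗ H_τ`, realized as `ℓ²(ℤ² × ℤ²)` through `δ_g ⊗ δ_h = δ_(g,h)`. -/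
abbrev Hτ2 : Type := lp (fun _ : (ℤ × ℤ) × (ℤ × ℤ) => ℂ) 2

/-- The vector `1 ∈ A_θ ⊆ H_τ`. -/
noncomputable def vacuum : Hτ := delta 0

variable (θ : ℝ)

/-- The phase in `V U^m V^n = λ^(-m) U^m V^(n+1)`. -/
noncomputable def phaseL (j : ℤ × ℤ) : Circle := (lam θ) ^ (-j.1)

/-- The phase in `U^m V^n U = λ^(-n) U^(m+1) V^n`. -/
noncomputable def phaseR (j : ℤ × ℤ) : Circle := (lam θ) ^ (-j.2)

/-- Left multiplication by `U`: `U_l (U^m V^n) = U^(m+1) V^n`. -/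
noncomputable def Ul : Hτ →L[ℂ] Hτ := shift (1, 0) (fun _ => 1)

/-- Left multiplication by `V`: `V_l (U^m V^n) = V U^m V^n = λ^(-m) U^m V^(n+1)`. -/
noncomputable def Vl : Hτ →L[ℂ] Hτ := shift (0, 1) (phaseL θ)

/-- Right multiplication by `U`: `U_r (U^m V^n) = U^m V^n U = λ^(-n) U^(m+1) V^n`. -/
noncomputable def Ur : Hτ →L[ℂ] Hτ := shift (1, 0) (phaseR θ)

/-- Right multiplication by `V`: `V_r (U^m V^n) = U^m V^(n+1)`. -/
noncomputable def Vr : Hτ →L[ℂ] Hτ := shift (0, 1) (fun _ => 1)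

theorem Ul_mul_Vl : Ul * Vl θ = (lam θ : ℂ) • (Vl θ * Ul) := by
  ext f i
  simp only [Ul, Vl, shift_mul, lp.coeFn_smul, Pi.smul_apply, smul_apply, shift_apply, phaseL,
    smul_eq_mul, ← mul_assoc, ← Circle.coe_mul]
  congr 2
  simp [zpow_sub]
  rfl

theorem Vr_mul_Ur : Vr * Ur θ = (lam θ : ℂ) • (Ur θ * Vr) := by
  ext f i
  simp only [Ur, Vr, shift_mul, lp.coeFn_smul, Pi.smul_apply, smul_apply, shift_apply, phaseR,
    smul_eq_mul, ← mul_assoc, ← Circle.coe_mul]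
  congr 2
  simp [zpow_sub]
  rfl

theorem commute_Ul_Ur : Commute Ul (Ur θ) := by
  rw [Commute, SemiconjBy, Ul, Ur, shift_mul, shift_mul]
  congr 1
  ext j; simp [phaseR]

theorem commute_Ul_Vr : Commute Ul Vr := by
  rw [Commute, SemiconjBy, Ul, Vr, shift_mul, shift_mul]
  simp

theorem commute_Vl_Ur : Commute (Vl θ) (Ur θ) := by
  rw [Commute, SemiconjBy, Vl, Ur, shift_mul, shift_mul]
  congr 1
  funext j
  simp only [phaseL, phaseR, Prod.fst_add, Prod.snd_add, ← zpow_add]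
  congr 1
  ring

theorem commute_Vl_Vr : Commute (Vl θ) Vr := by
  rw [Commute, SemiconjBy, Vl, Vr, shift_mul, shift_mul]
  congr 1
  ext j; simp [phaseL]

/-- The von Neumann algebra generated by a set of bounded operators: the double commutant of the
set together with its adjoints. -/
noncomputable def vnGenerated {H : Type*} [NormedAddCommGroup H] [InnerProductSpace ℂ H]
    [CompleteSpace H] (s : Set (H →L[ℂ] H)) : VonNeumannAlgebra H where
  toStarSubalgebra :=
    StarSubalgebra.centralizer ℂ (StarSubalgebra.centralizer ℂ s : Set (H →L[ℂ] H))
  centralizer_centralizer' := by simp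

/-- The hyperfinite `II₁` factor `A` (for irrational `θ`): the weak closure of
`A_θ = C⋆(U_l, V_l)` in `B(H_τ)`. -/
noncomputable def factor : VonNeumannAlgebra Hτ := vnGenerated {Ul, Vl θ}

theorem subset_vnGenerated {H : Type*} [NormedAddCommGroup H] [InnerProductSpace ℂ H]
    [CompleteSpace H] {s : Set (H →L[ℂ] H)} {x : H →L[ℂ] H} (hx : x ∈ s) : x ∈ vnGenerated s := by
  change x ∈ StarSubalgebra.centralizer ℂ (StarSubalgebra.centralizer ℂ s : Set (H →L[ℂ] H))
  rw [StarSubalgebra.mem_centralizer_iff]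
  intro g hg
  have h1 := (StarSubalgebra.mem_centralizer_iff ℂ).mp hg x hx
  have h2 := (StarSubalgebra.mem_centralizer_iff ℂ).mp (star_mem hg) x hx
  exact ⟨h1.1.symm, h2.1.symm⟩

theorem mem_commutant_vnGenerated {H : Type*} [NormedAddCommGroup H] [InnerProductSpace ℂ H]
    [CompleteSpace H] {s : Set (H →L[ℂ] H)} {x : H →L[ℂ] H}
    (hs : ∀ g ∈ s, g * x = x * g ∧ star g * x = x * star g) : x ∈ (vnGenerated s).commutant := by
  rw [VonNeumannAlgebra.mem_commutant_iff]
  intro g hg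
  have hx : x ∈ StarSubalgebra.centralizer ℂ s := (StarSubalgebra.mem_centralizer_iff ℂ).mpr hs
  exact ((StarSubalgebra.mem_centralizer_iff ℂ).mp hg x hx).1.symm

theorem commute_star_of_unitary {D : Type*} [Monoid D] [StarMul D] {u x : D} (hu : u ∈ unitary D)
    (h : Commute u x) : Commute (star u) x := by
  have e : star u = ↑(Unitary.toUnits ⟨u, hu⟩)⁻¹ := rfl
  rw [e]
  exact Commute.units_inv_left h

/-- `U_l` as an element of the factor. -/
noncomputable def UlElem : Elem (factor θ) := ⟨Ul, subset_vnGenerated (by simp)⟩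

/-- `V_l` as an element of the factor. -/
noncomputable def VlElem : Elem (factor θ) := ⟨Vl θ, subset_vnGenerated (by simp)⟩

theorem mem_commutant_factor {x : Hτ →L[ℂ] Hτ} (hu : Commute Ul x) (hv : Commute (Vl θ) x) :
    x ∈ (factor θ).commutant := by
  refine mem_commutant_vnGenerated fun g hg => ?_
  rcases hg with rfl | rfl
  · exact ⟨hu, commute_star_of_unitary (shift_mem_unitary _ _) hu⟩
  · exact ⟨hv, commute_star_of_unitary (shift_mem_unitary _ _) hv⟩

/-- `U_r` as an element of the commutant of the factor. -/
noncomputable def UrElem : Elem (factor θ).commutant :=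
  ⟨Ur θ, mem_commutant_factor θ (commute_Ul_Ur θ) (commute_Vl_Ur θ)⟩

/-- `V_r` as an element of the commutant of the factor. -/
noncomputable def VrElem : Elem (factor θ).commutant :=
  ⟨Vr, mem_commutant_factor θ commute_Ul_Vr (commute_Vl_Vr θ)⟩

/-- `U_l ⊗ 1` on `H_τ ⊗ H_τ`. -/
noncomputable def Ul2 : Hτ2 →L[ℂ] Hτ2 := shift ((1, 0), 0) (fun _ => 1)

/-- `V_l ⊗ 1` on `H_τ ⊗ H_τ`. -/
noncomputable def Vl2 : Hτ2 →L[ℂ] Hτ2 := shift ((0, 1), 0) (fun j => phaseL θ j.1)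

/-- `1 ⊗ U_r` on `H_τ ⊗ H_τ`. -/
noncomputable def Ur2 : Hτ2 →L[ℂ] Hτ2 := shift (0, (1, 0)) (fun j => phaseR θ j.2)

/-- `1 ⊗ V_r` on `H_τ ⊗ H_τ`. -/
noncomputable def Vr2 : Hτ2 →L[ℂ] Hτ2 := shift (0, (0, 1)) (fun _ => 1)

/-- The `*`-algebra `A^fin` generated by `U_l ⊗ 1`, `V_l ⊗ 1`, `1 ⊗ U_r` and `1 ⊗ V_r`. -/
noncomputable def Afin : StarSubalgebra ℂ (Hτ2 →L[ℂ] Hτ2) :=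
  StarAlgebra.adjoin ℂ {Ul2, Vl2 θ, Ur2 θ, Vr2}

/-- The second order irrational rotation algebra `A_θ^(2)`: the C⋆-algebra obtained by completing
`A^fin` in the norm of `B(H_τ ⊗ H_τ)`. -/
noncomputable def Atheta2 : StarSubalgebra ℂ (Hτ2 →L[ℂ] Hτ2) := (Afin θ).topologicalClosure

instance : IsClosed (Atheta2 θ : Set (Hτ2 →L[ℂ] Hτ2)) :=
  StarSubalgebra.isClosed_topologicalClosure _

/-- Four unitaries satisfying the relations of `U_l ⊗ 1`, `V_l ⊗ 1`, `1 ⊗ U_r`, `1 ⊗ V_r`. -/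
structure RotationRelations {D : Type*} [Ring D] [StarRing D] [Algebra ℂ D] (a b c d : D) :
    Prop where
  ua : a ∈ unitary D
  ub : b ∈ unitary D
  uc : c ∈ unitary D
  ud : d ∈ unitary D
  ab : a * b = (lam θ : ℂ) • (b * a)
  dc : d * c = (lam θ : ℂ) • (c * d)
  ac : Commute a c
  ad : Commute a d
  bc : Commute b c
  bd : Commute b d

theorem rotationRelations_Atheta2 : RotationRelations θ Ul2 (Vl2 θ) (Ur2 θ) Vr2 where
  ua := shift_mem_unitary _ _
  ub := shift_mem_unitary _ _
  uc := shift_mem_unitary _ _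
  ud := shift_mem_unitary _ _
  ab := by
    ext f i
    simp only [Ul2, Vl2, shift_mul, lp.coeFn_smul, Pi.smul_apply, smul_apply, shift_apply, phaseL,
      smul_eq_mul, ← mul_assoc, ← Circle.coe_mul]
    congr 2
    simp [zpow_sub]
    rfl
  dc := by
    ext f i
    simp only [Ur2, Vr2, shift_mul, lp.coeFn_smul, Pi.smul_apply, smul_apply, shift_apply, phaseR,
      smul_eq_mul, ← mul_assoc, ← Circle.coe_mul]
    congr 2
    simp [zpow_sub]
    rfl
  ac := by
    rw [Commute, SemiconjBy, Ul2, Ur2, shift_mul, shift_mul]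
    congr 1
    · ext j; simp [phaseR]
  ad := by
    rw [Commute, SemiconjBy, Ul2, Vr2, shift_mul, shift_mul]
    simp
  bc := by
    rw [Commute, SemiconjBy, Vl2, Ur2, shift_mul, shift_mul]
    congr 1
    funext j
    simp [mul_comm]
  bd := by
    rw [Commute, SemiconjBy, Vl2, Vr2, shift_mul, shift_mul]
    congr 1
    · ext j; simp [phaseL]

end Rotation

/-! ### Representations of `A^fin` extend to `A_θ^(2)` -/

section Extension

/-- The unitary `z ↦ z • 1`. -/
noncomputable def scalarUnitary (D : Type*) [Ring D] [StarRing D] [Algebra ℂ D] [StarModule ℂ D] :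
    Circle →* unitary D where
  toFun z := ⟨(z : ℂ) • 1, by
    have h : star (z : ℂ) * (z : ℂ) = 1 := by
      rw [Complex.star_def, ← Complex.normSq_eq_conj_mul_self]; simp
    rw [Unitary.mem_iff, star_smul, star_one, smul_mul_smul_comm, smul_mul_smul_comm, mul_one,
      mul_comm (z : ℂ), h, one_smul]
    exact ⟨rfl, rfl⟩⟩
  map_one' := by ext; simp
  map_mul' z w := by
    ext
    simp only [Circle.coe_mul, MulMemClass.mk_mul_mk, smul_mul_smul_comm, mul_one]

section Words

set_option linter.unusedSectionVars false

variable {D : Type*} [Ring D] [StarRing D] [Algebra ℂ D] [StarModule ℂ D]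

theorem scalarUnitary_mul_coe (z : Circle) (u : unitary D) :
    ((scalarUnitary D z * u : unitary D) : D) = (z : ℂ) • (u : D) := by
  change ((z : ℂ) • (1 : D)) * (u : D) = _
  rw [smul_mul_assoc, one_mul]

theorem scalarUnitary_commute (z : Circle) (u : unitary D) : Commute (scalarUnitary D z) u := by
  ext
  change ((z : ℂ) • (1 : D)) * (u : D) = (u : D) * ((z : ℂ) • (1 : D))
  rw [smul_mul_assoc, one_mul, mul_smul_comm, mul_one]

theorem mul_zpow_of_twist {u v : unitary D} {z : Circle} (h : v * u = scalarUnitary D z * (u * v)) (n : ℤ) :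
    v * u ^ n = scalarUnitary D (z ^ n) * (u ^ n * v) := by
  have h1 : v * u * v⁻¹ = scalarUnitary D z * u := by rw [h]; group
  have h2 : v * u ^ n * v⁻¹ = scalarUnitary D (z ^ n) * u ^ n := by
    rw [← conj_zpow, h1, (scalarUnitary_commute z u).mul_zpow, map_zpow]
  calc v * u ^ n = (v * u ^ n * v⁻¹) * v := by group
    _ = _ := by rw [h2, mul_assoc]

/-- The ordered monomials in four unitaries. -/
noncomputable def word (a b c d : unitary D) (g : (ℤ × ℤ) × (ℤ × ℤ)) : unitary D :=
  a ^ g.1.1 * (b ^ g.1.2 * (c ^ g.2.1 * d ^ g.2.2))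

/-- Left multiplication by `t` moves the monomials by `v`, up to phases. -/
def Moves (a b c d t : unitary D) (v : (ℤ × ℤ) × (ℤ × ℤ)) : Prop :=
  ∀ g, ∃ z : Circle, t * word a b c d g = scalarUnitary D z * word a b c d (v + g)

theorem Moves.inv {a b c d t : unitary D} {v : (ℤ × ℤ) × (ℤ × ℤ)} (h : Moves a b c d t v) :
    Moves a b c d t⁻¹ (-v) := by
  intro g
  obtain ⟨z, hz⟩ := h (-v + g)
  refine ⟨z⁻¹, ?_⟩
  rw [add_neg_cancel_left] at hz
  rw [map_inv, eq_inv_mul_iff_mul_eq, ← mul_assoc, (scalarUnitary_commute z t⁻¹).eq, mul_assoc,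
    ← hz, inv_mul_cancel_left]

theorem moves_a (a b c d : unitary D) : Moves a b c d a ((1, 0), 0) := by
  intro g
  refine ⟨1, ?_⟩
  simp [word, zpow_one_add, mul_assoc]

theorem moves_b {a b c d : unitary D} {z : Circle} (h : b * a = scalarUnitary D z * (a * b)) :
    Moves a b c d b ((0, 1), 0) := by
  intro g
  refine ⟨z ^ g.1.1, ?_⟩
  have := mul_zpow_of_twist h g.1.1
  simp only [word, Prod.fst_add, Prod.snd_add, zero_add, zpow_one_add]
  rw [← mul_assoc, this]
  simp only [mul_assoc]

theorem moves_c {a b c d : unitary D} (hac : Commute a c) (hbc : Commute b c) :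
    Moves a b c d c (0, (1, 0)) := by
  intro g
  refine ⟨1, ?_⟩
  have h1 := (hac.zpow_left g.1.1).eq
  have h2 := (hbc.zpow_left g.1.2).eq
  simp only [word, Prod.fst_add, Prod.snd_add, zero_add, zpow_one_add, map_one, one_mul]
  rw [← mul_assoc, ← h1, mul_assoc, ← mul_assoc c, ← h2]
  simp only [mul_assoc]

theorem moves_d {a b c d : unitary D} {z : Circle} (had : Commute a d) (hbd : Commute b d)
    (h : d * c = scalarUnitary D z * (c * d)) : Moves a b c d d (0, (0, 1)) := by
  intro g
  refine ⟨z ^ g.2.1, ?_⟩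
  have h1 := (had.zpow_left g.1.1).eq
  have h2 := (hbd.zpow_left g.1.2).eq
  have h3 := mul_zpow_of_twist h g.2.1
  simp only [word, Prod.fst_add, Prod.snd_add, zero_add, zpow_one_add]
  rw [← mul_assoc, ← h1, mul_assoc, ← mul_assoc d, ← h2, mul_assoc, ← mul_assoc d (c ^ _), h3,
    ← mul_assoc (scalarUnitary D _) (a ^ _), (scalarUnitary_commute _ (a ^ g.1.1)).eq, mul_assoc (a ^ _),
    ← mul_assoc (scalarUnitary D _) (b ^ _), (scalarUnitary_commute _ (b ^ g.1.2)).eq]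
  simp only [mul_assoc]

/-- The exponents of modulus at most `n`. -/
noncomputable def box (n : ℕ) : Finset ((ℤ × ℤ) × (ℤ × ℤ)) :=
  (Finset.Icc (-(n : ℤ)) n ×ˢ Finset.Icc (-(n : ℤ)) n) ×ˢ
    (Finset.Icc (-(n : ℤ)) n ×ˢ Finset.Icc (-(n : ℤ)) n)

theorem card_box (n : ℕ) : (box n).card = (2 * n + 1) ^ 4 := by
  simp only [box, Finset.card_product, Int.card_Icc]
  have : ((n : ℤ) + 1 - -(n : ℤ)).toNat = 2 * n + 1 := by omega
  rw [this]; ring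

/-- The linear span of the monomials with exponents in the box of size `n`. -/
noncomputable def wordSpan (a b c d : unitary D) (n : ℕ) : Submodule ℂ D :=
  Submodule.span ℂ ((fun g => (word a b c d g : D)) '' (box n : Set ((ℤ × ℤ) × (ℤ × ℤ))))

theorem wordSpan_mono (a b c d : unitary D) {n m : ℕ} (h : n ≤ m) :
    wordSpan a b c d n ≤ wordSpan a b c d m := by
  refine Submodule.span_mono (Set.image_mono ?_)
  intro g hg
  simp only [box, Finset.coe_product, Set.mem_prod, Finset.coe_Icc, Set.mem_Icc] at hg ⊢
  omega

theorem Moves.wordSpan {a b c d t : unitary D} {v : (ℤ × ℤ) × (ℤ × ℤ)} (h : Moves a b c d t v)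
    (hv : v ∈ box 1) (n : ℕ) {y : D} (hy : y ∈ wordSpan a b c d n) :
    (t : D) * y ∈ CPMaps.wordSpan a b c d (n + 1) := by
  induction hy using Submodule.span_induction with
  | zero => simp
  | add x y _ _ hx hy => rw [mul_add]; exact add_mem hx hy
  | smul r x _ hx => rw [mul_smul_comm]; exact Submodule.smul_mem _ r hx
  | mem x hx =>
    obtain ⟨g, hg, rfl⟩ := hx
    obtain ⟨z, hz⟩ := h g
    have e := congrArg (Subtype.val) hz
    rw [scalarUnitary_mul_coe] at e
    change (t : D) * (word a b c d g : D) ∈ _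
    rw [show (t : D) * (word a b c d g : D) = _ from e]
    refine Submodule.smul_mem _ _ (Submodule.subset_span ⟨v + g, ?_, rfl⟩)
    simp only [box, Finset.coe_product, Set.mem_prod, Finset.coe_Icc, Set.mem_Icc,
      Finset.mem_product, Finset.mem_Icc, Prod.fst_add, Prod.snd_add, Nat.cast_add,
      Nat.cast_one] at hg hv ⊢
    omega

theorem exists_growth {a b c d : unitary D} {va vb vc vd : (ℤ × ℤ) × (ℤ × ℤ)}
    (ha : Moves a b c d a va) (hb : Moves a b c d b vb) (hc : Moves a b c d c vc)
    (hd : Moves a b c d d vd) (hva : va ∈ box 1) (hvb : vb ∈ box 1) (hvc : vc ∈ box 1)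
    (hvd : vd ∈ box 1) {x : D} (hx : x ∈ StarAlgebra.adjoin ℂ {(a : D), (b : D), (c : D), (d : D)}) :
    ∃ r : ℕ, ∀ n, ∀ y ∈ wordSpan a b c d n, x * y ∈ wordSpan a b c d (n + r) := by
  have hneg : ∀ v : (ℤ × ℤ) × (ℤ × ℤ), v ∈ box 1 → -v ∈ box 1 := by
    intro v hv
    simp only [box, Finset.mem_product, Finset.mem_Icc, Prod.fst_neg, Prod.snd_neg] at hv ⊢
    omega
  have gen : ∀ (t : unitary D) v, Moves a b c d t v → v ∈ box 1 → ∀ s : D, (s = t ∨ star s = t) →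
      ∃ r : ℕ, ∀ n, ∀ y ∈ wordSpan a b c d n, s * y ∈ wordSpan a b c d (n + r) := by
    rintro t v h hv s (rfl | hs)
    · exact ⟨1, fun n y hy => h.wordSpan hv n hy⟩
    · have : s = ((t⁻¹ : unitary D) : D) := by
        rw [← star_star s, hs]; rfl
      rw [this]
      exact ⟨1, fun n y hy => h.inv.wordSpan (hneg v hv) n hy⟩
  change x ∈ Algebra.adjoin ℂ _ at hx
  induction hx using Algebra.adjoin_induction with
  | mem s hs =>
    have hs' : (s = a ∨ star s = a) ∨ (s = b ∨ star s = b) ∨ (s = c ∨ star s = c) ∨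
        (s = d ∨ star s = d) := by
      simp only [Set.mem_union, Set.mem_star, Set.mem_insert_iff, Set.mem_singleton_iff] at hs
      tauto
    rcases hs' with h | h | h | h
    · exact gen a va ha hva s h
    · exact gen b vb hb hvb s h
    · exact gen c vc hc hvc s h
    · exact gen d vd hd hvd s h
  | algebraMap z =>
    refine ⟨0, fun n y hy => ?_⟩
    rw [← Algebra.smul_def]
    exact Submodule.smul_mem _ z hy
  | add x y _ _ hx hy =>
    obtain ⟨r, hr⟩ := hx
    obtain ⟨s, hs⟩ := hy
    refine ⟨r + s, fun n w hw => ?_⟩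
    rw [add_mul]
    exact add_mem (wordSpan_mono a b c d (by omega) (hr n w hw))
      (wordSpan_mono a b c d (by omega) (hs n w hw))
  | mul x y _ _ hx hy =>
    obtain ⟨r, hr⟩ := hx
    obtain ⟨s, hs⟩ := hy
    refine ⟨s + r, fun n w hw => ?_⟩
    rw [mul_assoc, ← add_assoc]
    exact hr _ _ (hs n w hw)

theorem one_mem_wordSpan (a b c d : unitary D) : (1 : D) ∈ wordSpan a b c d 0 :=
  Submodule.subset_span ⟨((0, 0), (0, 0)), by simp [box], by simp [word]⟩

end Words

/-- The operator sends each `δ_j` to a unimodular multiple of `δ_(v + j)`. -/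
def Monomial (X : Hτ2 →L[ℂ] Hτ2) (v : (ℤ × ℤ) × (ℤ × ℤ)) : Prop :=
  ∀ j, ∃ z : Circle, X (delta j) = (z : ℂ) • delta (v + j)

theorem Monomial.mul {X Y : Hτ2 →L[ℂ] Hτ2} {v w : (ℤ × ℤ) × (ℤ × ℤ)} (hX : Monomial X v)
    (hY : Monomial Y w) : Monomial (X * Y) (v + w) := by
  intro j
  obtain ⟨z, hz⟩ := hY j
  obtain ⟨z', hz'⟩ := hX (w + j)
  refine ⟨z * z', ?_⟩
  rw [mul_apply_eq_comp, hz, map_smul, hz', smul_smul, Circle.coe_mul, add_assoc]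

theorem Monomial.zpow {X : unitary (Hτ2 →L[ℂ] Hτ2)} {v : (ℤ × ℤ) × (ℤ × ℤ)}
    (hX : Monomial (X : Hτ2 →L[ℂ] Hτ2) v) (n : ℤ) :
    Monomial ((X ^ n : unitary (Hτ2 →L[ℂ] Hτ2)) : Hτ2 →L[ℂ] Hτ2) (n • v) := by
  have hinv : Monomial ((X⁻¹ : unitary (Hτ2 →L[ℂ] Hτ2)) : Hτ2 →L[ℂ] Hτ2) (-v) := by
    intro j
    obtain ⟨z, hz⟩ := hX (-v + j)
    refine ⟨z⁻¹, ?_⟩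
    rw [add_neg_cancel_left] at hz
    have h1 : ((X⁻¹ : unitary (Hτ2 →L[ℂ] Hτ2)) : Hτ2 →L[ℂ] Hτ2)
        ((X : Hτ2 →L[ℂ] Hτ2) (delta (-v + j))) = delta (-v + j) := by
      rw [← mul_apply_eq_comp, ← MulMemClass.coe_mul, inv_mul_cancel]
      rfl
    rw [hz, map_smul] at h1
    rw [← h1, smul_smul, ← Circle.coe_mul, inv_mul_cancel, Circle.coe_one, one_smul]
  induction n with
  | zero => exact fun j => ⟨1, by simp⟩
  | succ n ih =>
    rw [zpow_add_one, add_smul, one_smul]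
    exact ih.mul hX
  | pred n ih =>
    rw [zpow_sub_one, sub_smul, one_smul, sub_eq_add_neg]
    exact ih.mul hinv

theorem shift_monomial (v : (ℤ × ℤ) × (ℤ × ℤ)) (w : (ℤ × ℤ) × (ℤ × ℤ) → Circle) :
    Monomial (shift v w) v := fun j => ⟨w j, shift_delta v w j⟩

theorem coord_delta (g h : (ℤ × ℤ) × (ℤ × ℤ)) :
    (delta g : Hτ2) h = if h = g then 1 else 0 := by
  rw [delta, lp.single_apply, Pi.single_apply]

theorem norm_delta (g : (ℤ × ℤ) × (ℤ × ℤ)) : ‖(delta g : Hτ2)‖ = 1 := by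
  rw [delta, lp.norm_single (by norm_num)]; simp

theorem le_of_growth {p q : ℝ} (hp : 0 ≤ p) (r : ℕ)
    (h : ∀ k : ℕ, q ^ 2 ^ k ≤ ((2 * (2 ^ k * r : ℕ) + 1 : ℕ) : ℝ) ^ 4 * p ^ 2 ^ k) : q ≤ p := by
  by_contra hlt
  push Not at hlt
  have hq : 0 < q := hp.trans_lt hlt
  have hab : |p / q| < 1 := by
    rw [abs_of_nonneg (by positivity), div_lt_one hq]; exact hlt
  have h1 := (tendsto_pow_const_mul_const_pow_of_abs_lt_one 4 hab).const_mul
    (((2 * r + 1 : ℕ) : ℝ) ^ 4)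
  rw [mul_zero] at h1
  have h2 : Filter.Tendsto (fun k : ℕ => 2 ^ k) Filter.atTop Filter.atTop :=
    tendsto_pow_atTop_atTop_of_one_lt (by norm_num : 1 < 2)
  have h3 := (h1.comp h2).eventually (gt_mem_nhds (zero_lt_one))
  obtain ⟨k, hk⟩ := h3.exists
  simp only [Function.comp] at hk
  have h4 : (1 : ℝ) ≤ ((2 * (2 ^ k * r : ℕ) + 1 : ℕ) : ℝ) ^ 4 * (p / q) ^ 2 ^ k := by
    rw [div_pow, ← mul_div_assoc, le_div_iff₀ (by positivity), one_mul]
    exact h k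
  have h5 : ((2 * (2 ^ k * r : ℕ) + 1 : ℕ) : ℝ) ≤ ((2 * r + 1 : ℕ) : ℝ) * ((2 ^ k : ℕ) : ℝ) := by
    have : 1 ≤ 2 ^ k := Nat.one_le_two_pow
    rw [← Nat.cast_mul]
    exact Nat.cast_le.mpr (by nlinarith)
  have h6 : ((2 * (2 ^ k * r : ℕ) + 1 : ℕ) : ℝ) ^ 4 * (p / q) ^ 2 ^ k ≤
      (((2 * r + 1 : ℕ) : ℝ) * ((2 ^ k : ℕ) : ℝ)) ^ 4 * (p / q) ^ 2 ^ k := by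
    gcongr
  rw [mul_pow, mul_assoc] at h6
  linarith

variable {K : Type*} [NormedAddCommGroup K] [InnerProductSpace ℂ K] [CompleteSpace K]
variable {θ : ℝ} {a b c d : K →L[ℂ] K}

/-- The pairs `(X, Y)` in the `*`-algebra generated by the four pairs of generators. -/
noncomputable def pairAlg (θ : ℝ) (a b c d : K →L[ℂ] K) :
    StarSubalgebra ℂ ((Hτ2 →L[ℂ] Hτ2) × (K →L[ℂ] K)) :=
  StarAlgebra.adjoin ℂ {(Ul2, a), (Vl2 θ, b), (Ur2 θ, c), (Vr2, d)}

theorem mem_unitary_prod {A B : Type*} [Ring A] [StarRing A] [Ring B] [StarRing B] {x : A} {y : B}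
    (hx : x ∈ unitary A) (hy : y ∈ unitary B) : (x, y) ∈ unitary (A × B) := by
  rw [Unitary.mem_iff] at *
  exact ⟨Prod.ext hx.1 hy.1, Prod.ext hx.2 hy.2⟩

theorem box_one₁ : (((1, 0), 0) : (ℤ × ℤ) × (ℤ × ℤ)) ∈ box 1 := by simp [box]

theorem box_one₂ : (((0, 1), 0) : (ℤ × ℤ) × (ℤ × ℤ)) ∈ box 1 := by simp [box]

theorem box_one₃ : ((0, (1, 0)) : (ℤ × ℤ) × (ℤ × ℤ)) ∈ box 1 := by simp [box]

theorem box_one₄ : ((0, (0, 1)) : (ℤ × ℤ) × (ℤ × ℤ)) ∈ box 1 := by simp [box]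

/-- The first component of a pair of unitaries. -/
def unitaryFst (B E : Type*) [Ring B] [StarRing B] [Ring E] [StarRing E] :
    unitary (B × E) →* unitary B where
  toFun u := ⟨(u : B × E).1, Unitary.mem_iff.mpr ⟨congrArg Prod.fst (Unitary.mem_iff.mp u.2).1,
    congrArg Prod.fst (Unitary.mem_iff.mp u.2).2⟩⟩
  map_one' := rfl
  map_mul' _ _ := rfl

theorem word_fst_delta {a b c d : unitary ((Hτ2 →L[ℂ] Hτ2) × (K →L[ℂ] K))}
    (ha : Monomial (unitaryFst _ _ a : Hτ2 →L[ℂ] Hτ2) ((1, 0), 0))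
    (hb : Monomial (unitaryFst _ _ b : Hτ2 →L[ℂ] Hτ2) ((0, 1), 0))
    (hc : Monomial (unitaryFst _ _ c : Hτ2 →L[ℂ] Hτ2) (0, (1, 0)))
    (hd : Monomial (unitaryFst _ _ d : Hτ2 →L[ℂ] Hτ2) (0, (0, 1))) (g : (ℤ × ℤ) × (ℤ × ℤ)) :
    ∃ z : Circle, (word a b c d g : (Hτ2 →L[ℂ] Hτ2) × (K →L[ℂ] K)).1 (delta 0) =
      (z : ℂ) • delta g := by
  have e1 : (word a b c d g : (Hτ2 →L[ℂ] Hτ2) × (K →L[ℂ] K)).1 =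
      (unitaryFst _ _ (word a b c d g) : Hτ2 →L[ℂ] Hτ2) := rfl
  obtain ⟨z, hz⟩ := ((ha.zpow g.1.1).mul
    ((hb.zpow g.1.2).mul ((hc.zpow g.2.1).mul (hd.zpow g.2.2)))) 0
  refine ⟨z, ?_⟩
  rw [e1, word, map_mul, map_mul, map_mul, map_zpow, map_zpow, map_zpow, map_zpow]
  refine hz.trans ?_
  congr 2
  ext <;> simp

theorem norm_snd_le (u : unitary ((Hτ2 →L[ℂ] Hτ2) × (K →L[ℂ] K))) :
    ‖(u : (Hτ2 →L[ℂ] Hτ2) × (K →L[ℂ] K)).2‖ ≤ 1 := by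
  have h1 := congrArg Prod.snd (Unitary.mem_iff.mp u.2).1
  have h2 := congrArg Prod.snd (Unitary.mem_iff.mp u.2).2
  refine opNorm_le_bound _ zero_le_one fun k => ?_
  rw [one_mul]
  exact (norm_map_of_mem_unitary (Unitary.mem_iff.mpr ⟨h1, h2⟩) k).le

theorem norm_snd_le_of_mem_wordSpan {a b c d : unitary ((Hτ2 →L[ℂ] Hτ2) × (K →L[ℂ] K))}
    (hmon : ∀ g, ∃ z : Circle, (word a b c d g : (Hτ2 →L[ℂ] Hτ2) × (K →L[ℂ] K)).1 (delta 0) =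
      (z : ℂ) • delta g) (n : ℕ) {y : (Hτ2 →L[ℂ] Hτ2) × (K →L[ℂ] K)}
    (hy : y ∈ wordSpan a b c d n) : ‖y.2‖ ≤ ((2 * n + 1 : ℕ) : ℝ) ^ 4 * ‖y.1‖ := by
  obtain ⟨f, hf⟩ := (Submodule.mem_span_image_finset_iff_exists_fun' ℂ).mp hy
  choose z hz using hmon
  have hcoord : ∀ g ∈ box n, ‖f g‖ ≤ ‖y.1‖ := by
    intro g hg
    have e1 : y.1 (delta 0) = ∑ i ∈ box n, (f i * z i) • (delta i : Hτ2) := by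
      rw [← hf, Prod.fst_sum, sum_apply]
      refine Finset.sum_congr rfl fun i _ => ?_
      rw [Prod.smul_fst, smul_apply, hz, smul_smul]
    have e2 : (y.1 (delta 0)) g = f g * z g := by
      rw [e1, lp.coeFn_sum, Finset.sum_apply, Finset.sum_eq_single g]
      · rw [lp.coeFn_smul, Pi.smul_apply, coord_delta]; simp
      · intro i _ hi
        rw [lp.coeFn_smul, Pi.smul_apply, coord_delta, if_neg hi.symm, smul_zero]
      · exact fun h => absurd hg h
    have e3 : ‖f g‖ = ‖(y.1 (delta 0)) g‖ := by
      rw [e2, norm_mul, Circle.norm_coe, mul_one]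
    rw [e3]
    refine (lp.norm_apply_le_norm (by norm_num) _ g).trans ?_
    refine (y.1.le_opNorm _).trans ?_
    rw [norm_delta, mul_one]
  calc ‖y.2‖ ≤ ∑ i ∈ box n, ‖f i • (word a b c d i : (Hτ2 →L[ℂ] Hτ2) × (K →L[ℂ] K)).2‖ := by
        rw [← hf, Prod.snd_sum]; exact norm_sum_le _ _
    _ ≤ ∑ i ∈ box n, ‖y.1‖ := by
        refine Finset.sum_le_sum fun i hi => ?_
        rw [norm_smul]
        refine le_trans ?_ (hcoord i hi)
        exact mul_le_of_le_one_right (norm_nonneg _) (norm_snd_le _)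
    _ = _ := by
        rw [Finset.sum_const, card_box, nsmul_eq_mul, Nat.cast_pow]

theorem norm_snd_le_norm_fst {S : StarSubalgebra ℂ ((Hτ2 →L[ℂ] Hτ2) × (K →L[ℂ] K))}
    {a b c d : unitary ((Hτ2 →L[ℂ] Hτ2) × (K →L[ℂ] K))}
    (hmon : ∀ g, ∃ z : Circle, (word a b c d g : (Hτ2 →L[ℂ] Hτ2) × (K →L[ℂ] K)).1 (delta 0) =
      (z : ℂ) • delta g)
    (hS : ∀ x ∈ S, ∃ r : ℕ, ∀ n, ∀ y ∈ wordSpan a b c d n, x * y ∈ wordSpan a b c d (n + r))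
    {x : (Hτ2 →L[ℂ] Hτ2) × (K →L[ℂ] K)} (hx : x ∈ S) : ‖x.2‖ ≤ ‖x.1‖ := by
  obtain ⟨r, hr⟩ := hS (star x * x) (mul_mem (star_mem hx) hx)
  have hpow : ∀ m : ℕ, (star x * x) ^ m ∈ wordSpan a b c d (m * r) := by
    intro m
    induction m with
    | zero => rw [pow_zero, zero_mul]; exact one_mem_wordSpan a b c d
    | succ m ih =>
      rw [pow_succ', Nat.succ_mul]
      exact hr _ _ ih
  have hsq : ‖x.2‖ ^ 2 ≤ ‖x.1‖ ^ 2 := by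
    refine le_of_growth (by positivity) r fun k => ?_
    have h1 := norm_snd_le_of_mem_wordSpan hmon _ (hpow (2 ^ k))
    have e1 : ‖((star x * x) ^ 2 ^ k).1‖ = (‖x.1‖ ^ 2) ^ 2 ^ k := by
      rw [Prod.pow_fst, Prod.fst_mul, Prod.fst_star,
        (IsSelfAdjoint.star_mul_self x.1).norm_pow_two_pow, CStarRing.norm_star_mul_self, sq]
    have e2 : ‖((star x * x) ^ 2 ^ k).2‖ = (‖x.2‖ ^ 2) ^ 2 ^ k := by
      rw [Prod.pow_snd, Prod.snd_mul, Prod.snd_star,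
        (IsSelfAdjoint.star_mul_self x.2).norm_pow_two_pow, CStarRing.norm_star_mul_self, sq]
    rwa [e1, e2] at h1
  exact le_of_sq_le_sq hsq (norm_nonneg _)

theorem exists_growth_of_relations {D : Type*} [Ring D] [StarRing D] [Algebra ℂ D]
    [StarModule ℂ D] {a b c d : unitary D} {z : Circle} (hab : a * b = scalarUnitary D z * (b * a))
    (hdc : d * c = scalarUnitary D z * (c * d)) (hac : Commute a c) (had : Commute a d)
    (hbc : Commute b c) (hbd : Commute b d) {x : D}
    (hx : x ∈ StarAlgebra.adjoin ℂ {(a : D), (b : D), (c : D), (d : D)}) :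
    ∃ r : ℕ, ∀ n, ∀ y ∈ wordSpan a b c d n, x * y ∈ wordSpan a b c d (n + r) := by
  have hba : b * a = scalarUnitary D z⁻¹ * (a * b) := by
    rw [hab, map_inv, inv_mul_cancel_left]
  exact exists_growth (moves_a a b c d) (moves_b hba) (moves_c hac hbc) (moves_d had hbd hdc)
    box_one₁ box_one₂ box_one₃ box_one₄ hx

theorem RotationRelations.norm_le (h : RotationRelations θ a b c d)
    {x : (Hτ2 →L[ℂ] Hτ2) × (K →L[ℂ] K)} (hx : x ∈ pairAlg θ a b c d) : ‖x.2‖ ≤ ‖x.1‖ := by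
  have h0 := rotationRelations_Atheta2 θ
  let A : unitary ((Hτ2 →L[ℂ] Hτ2) × (K →L[ℂ] K)) := ⟨(Ul2, a), mem_unitary_prod h0.ua h.ua⟩
  let B : unitary ((Hτ2 →L[ℂ] Hτ2) × (K →L[ℂ] K)) := ⟨(Vl2 θ, b), mem_unitary_prod h0.ub h.ub⟩
  let C : unitary ((Hτ2 →L[ℂ] Hτ2) × (K →L[ℂ] K)) := ⟨(Ur2 θ, c), mem_unitary_prod h0.uc h.uc⟩
  let E : unitary ((Hτ2 →L[ℂ] Hτ2) × (K →L[ℂ] K)) := ⟨(Vr2, d), mem_unitary_prod h0.ud h.ud⟩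
  have hAB : A * B = scalarUnitary _ (lam θ) * (B * A) := by
    ext1
    rw [scalarUnitary_mul_coe]
    exact Prod.ext h0.ab h.ab
  have hEC : E * C = scalarUnitary _ (lam θ) * (C * E) := by
    ext1
    rw [scalarUnitary_mul_coe]
    exact Prod.ext h0.dc h.dc
  have hAC : Commute A C := Subtype.ext (Prod.ext h0.ac h.ac)
  have hAE : Commute A E := Subtype.ext (Prod.ext h0.ad h.ad)
  have hBC : Commute B C := Subtype.ext (Prod.ext h0.bc h.bc)
  have hBE : Commute B E := Subtype.ext (Prod.ext h0.bd h.bd)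
  have hmon := word_fst_delta (K := K) (a := A) (b := B) (c := C) (d := E)
    (shift_monomial _ _) (shift_monomial _ _) (shift_monomial _ _) (shift_monomial _ _)
  exact norm_snd_le_norm_fst (S := pairAlg θ a b c d) hmon
    (fun y hy => exists_growth_of_relations hAB hEC hAC hAE hBC hBE hy) hx

section PairAlgebra

variable {B E : Type*} [Ring B] [StarRing B] [Algebra ℂ B] [StarModule ℂ B] [Ring E] [StarRing E]
  [Algebra ℂ E] [StarModule ℂ E] (S : StarSubalgebra ℂ (B × E))

theorem mk_mul_mem {x x' : B} {y y' : E} (h : (x, y) ∈ S) (h' : (x', y') ∈ S) :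
    (x * x', y * y') ∈ S := mul_mem h h'

theorem mk_add_mem {x x' : B} {y y' : E} (h : (x, y) ∈ S) (h' : (x', y') ∈ S) :
    (x + x', y + y') ∈ S := add_mem h h'

theorem mk_star_mem {x : B} {y : E} (h : (x, y) ∈ S) : (star x, star y) ∈ S := star_mem h

theorem mk_smul_one_mem (r : ℂ) : (r • (1 : B), r • (1 : E)) ∈ S :=
  SMulMemClass.smul_mem r (one_mem S)

end PairAlgebra

/-- The C⋆-algebra of the pairs `(X, π X)`: the graph of the representation to be constructed. -/
noncomputable def graphAlg (θ : ℝ) (a b c d : K →L[ℂ] K) :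
    StarSubalgebra ℂ ((Hτ2 →L[ℂ] Hτ2) × (K →L[ℂ] K)) := (pairAlg θ a b c d).topologicalClosure

theorem RotationRelations.norm_le_graph (h : RotationRelations θ a b c d)
    {x : (Hτ2 →L[ℂ] Hτ2) × (K →L[ℂ] K)} (hx : x ∈ graphAlg θ a b c d) : ‖x.2‖ ≤ ‖x.1‖ := by
  have hcl : IsClosed {x : (Hτ2 →L[ℂ] Hτ2) × (K →L[ℂ] K) | ‖x.2‖ ≤ ‖x.1‖} :=
    isClosed_le continuous_snd.norm continuous_fst.norm
  exact closure_minimal (fun y hy => h.norm_le hy) hcl hx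

theorem RotationRelations.exists_graph (h : RotationRelations θ a b c d) (X : Atheta2 θ) :
    ∃ Y, ((X : Hτ2 →L[ℂ] Hτ2), Y) ∈ graphAlg θ a b c d := by
  let f : graphAlg θ a b c d → (Hτ2 →L[ℂ] Hτ2) := fun x => x.1.1
  have hf : Isometry f := by
    refine Isometry.of_dist_eq fun x y => ?_
    have h1 := h.norm_le_graph (sub_mem x.2 y.2)
    rw [Subtype.dist_eq, dist_eq_norm, dist_eq_norm, Prod.norm_def, max_eq_left h1]
    rfl
  have hcs : CompleteSpace (graphAlg θ a b c d) :=
    (StarSubalgebra.isClosed_topologicalClosure _).completeSpace_coe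
  have hcl : IsClosed (Set.range f) := hf.isClosedEmbedding.isClosed_range
  have hsub : (Afin θ : Set (Hτ2 →L[ℂ] Hτ2)) ⊆ Set.range f := by
    have e : Afin θ = (pairAlg θ a b c d).map (StarAlgHom.fst ℂ _ _) := by
      rw [pairAlg, StarAlgHom.map_adjoin, Afin]
      congr 1
      simp [Set.image_insert_eq]
    rw [e]
    rintro _ ⟨x, hx, rfl⟩
    exact ⟨⟨x, StarSubalgebra.le_topologicalClosure _ hx⟩, rfl⟩
  obtain ⟨x, hx⟩ := closure_minimal hsub hcl X.2
  refine ⟨x.1.2, ?_⟩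
  rw [← hx]
  exact x.2

theorem RotationRelations.graph_unique (h : RotationRelations θ a b c d) {X : Hτ2 →L[ℂ] Hτ2}
    {Y Y' : K →L[ℂ] K} (hY : (X, Y) ∈ graphAlg θ a b c d) (hY' : (X, Y') ∈ graphAlg θ a b c d) :
    Y = Y' := by
  have h1 := h.norm_le_graph (sub_mem hY hY')
  simp only [Prod.mk_sub_mk, sub_self, norm_zero] at h1
  exact sub_eq_zero.mp (norm_le_zero_iff.mp h1)

/-- The operator `π X`, determined by `(X, π X)` belonging to the graph. -/
noncomputable def RotationRelations.repFun (h : RotationRelations θ a b c d) (X : Atheta2 θ) :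
    K →L[ℂ] K := (h.exists_graph X).choose

theorem RotationRelations.repFun_mem (h : RotationRelations θ a b c d) (X : Atheta2 θ) :
    ((X : Hτ2 →L[ℂ] Hτ2), h.repFun X) ∈ graphAlg θ a b c d := (h.exists_graph X).choose_spec

theorem RotationRelations.repFun_eq (h : RotationRelations θ a b c d) {X : Atheta2 θ}
    {Y : K →L[ℂ] K} (hY : ((X : Hτ2 →L[ℂ] Hτ2), Y) ∈ graphAlg θ a b c d) : h.repFun X = Y :=
  h.graph_unique (h.repFun_mem X) hY

theorem RotationRelations.repFun_smul_one (h : RotationRelations θ a b c d) (r : ℂ) :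
    h.repFun (r • 1) = r • 1 := h.repFun_eq (mk_smul_one_mem (graphAlg θ a b c d) r)

theorem RotationRelations.repFun_mul (h : RotationRelations θ a b c d) (X Y : Atheta2 θ) :
    h.repFun (X * Y) = h.repFun X * h.repFun Y :=
  h.repFun_eq (mk_mul_mem (graphAlg θ a b c d) (h.repFun_mem X) (h.repFun_mem Y))

theorem RotationRelations.repFun_add (h : RotationRelations θ a b c d) (X Y : Atheta2 θ) :
    h.repFun (X + Y) = h.repFun X + h.repFun Y :=
  h.repFun_eq (mk_add_mem (graphAlg θ a b c d) (h.repFun_mem X) (h.repFun_mem Y))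

theorem RotationRelations.repFun_star (h : RotationRelations θ a b c d) (X : Atheta2 θ) :
    h.repFun (star X) = star (h.repFun X) :=
  h.repFun_eq (mk_star_mem (graphAlg θ a b c d) (h.repFun_mem X))

/-- The representation of `A_θ^(2)` determined by four unitaries satisfying the relations. -/
noncomputable def RotationRelations.rep (h : RotationRelations θ a b c d) :
    Atheta2 θ →⋆ₐ[ℂ] (K →L[ℂ] K) where
  toFun := h.repFun
  map_one' := h.repFun_eq (one_mem (graphAlg θ a b c d))
  map_mul' := h.repFun_mul
  map_zero' := h.repFun_eq (zero_mem (graphAlg θ a b c d))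
  map_add' := h.repFun_add
  commutes' r := by
    rw [Algebra.algebraMap_eq_smul_one, Algebra.algebraMap_eq_smul_one]
    exact h.repFun_smul_one r
  map_star' := h.repFun_star

theorem RotationRelations.rep_eq (h : RotationRelations θ a b c d) (X : Atheta2 θ) {Y : K →L[ℂ] K}
    (hY : ((X : Hτ2 →L[ℂ] Hτ2), Y) ∈ graphAlg θ a b c d) : h.rep X = Y := h.repFun_eq hY

end Extension

section GNS

theorem mem_Atheta2 (θ : ℝ) {X : Hτ2 →L[ℂ] Hτ2} (h : X ∈ ({Ul2, Vl2 θ, Ur2 θ, Vr2} : Set _)) :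
    X ∈ Atheta2 θ :=
  StarSubalgebra.le_topologicalClosure _ (StarAlgebra.subset_adjoin ℂ _ h)

/-- `U_l ⊗ 1` in `A_θ^(2)`. -/
noncomputable def Ul2Elem (θ : ℝ) : Atheta2 θ := ⟨Ul2, mem_Atheta2 θ (by simp)⟩

/-- `V_l ⊗ 1` in `A_θ^(2)`. -/
noncomputable def Vl2Elem (θ : ℝ) : Atheta2 θ := ⟨Vl2 θ, mem_Atheta2 θ (by simp)⟩

/-- `1 ⊗ U_r` in `A_θ^(2)`. -/
noncomputable def Ur2Elem (θ : ℝ) : Atheta2 θ := ⟨Ur2 θ, mem_Atheta2 θ (by simp)⟩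

/-- `1 ⊗ V_r` in `A_θ^(2)`. -/
noncomputable def Vr2Elem (θ : ℝ) : Atheta2 θ := ⟨Vr2, mem_Atheta2 θ (by simp)⟩

section Values

variable {K : Type*} [NormedAddCommGroup K] [InnerProductSpace ℂ K] [CompleteSpace K]
variable {θ : ℝ} {a b c d : K →L[ℂ] K}

theorem mem_graphAlg {x : (Hτ2 →L[ℂ] Hτ2) × (K →L[ℂ] K)}
    (hx : x ∈ ({(Ul2, a), (Vl2 θ, b), (Ur2 θ, c), (Vr2, d)} :
      Set ((Hτ2 →L[ℂ] Hτ2) × (K →L[ℂ] K)))) : x ∈ graphAlg θ a b c d :=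
  StarSubalgebra.le_topologicalClosure _ (StarAlgebra.subset_adjoin ℂ _ hx)

theorem RotationRelations.rep_Ul2 (h : RotationRelations θ a b c d) : h.rep (Ul2Elem θ) = a :=
  h.rep_eq (Ul2Elem θ) (mem_graphAlg (x := (Ul2, a)) (by simp))

theorem RotationRelations.rep_Vl2 (h : RotationRelations θ a b c d) : h.rep (Vl2Elem θ) = b :=
  h.rep_eq (Vl2Elem θ) (mem_graphAlg (x := (Vl2 θ, b)) (by simp))

theorem RotationRelations.rep_Ur2 (h : RotationRelations θ a b c d) : h.rep (Ur2Elem θ) = c :=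
  h.rep_eq (Ur2Elem θ) (mem_graphAlg (x := (Ur2 θ, c)) (by simp))

theorem RotationRelations.rep_Vr2 (h : RotationRelations θ a b c d) : h.rep (Vr2Elem θ) = d :=
  h.rep_eq (Vr2Elem θ) (mem_graphAlg (x := (Vr2, d)) (by simp))

end Values

theorem map_mem_unitary {B D : Type*} [Ring B] [StarRing B] [Algebra ℂ B] [Ring D] [StarRing D]
    [Algebra ℂ D] (f : B →⋆ₐ[ℂ] D) {u : B} (hu : u ∈ unitary B) : f u ∈ unitary D := by
  rw [Unitary.mem_iff] at *
  rw [← map_star, ← map_mul, ← map_mul, hu.1, hu.2, map_one]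
  exact ⟨rfl, rfl⟩

variable {θ : ℝ}

theorem NormalUCP.rotationRelations (T : NormalUCP (factor θ)) :
    RotationRelations θ (T.pi (UlElem θ)) (T.pi (VlElem θ)) (T.rho (UrElem θ))
      (T.rho (VrElem θ)) where
  ua := map_mem_unitary _ (Unitary.mem_iff.mpr
    ⟨Subtype.ext (Unitary.mem_iff.mp (shift_mem_unitary _ _)).1,
      Subtype.ext (Unitary.mem_iff.mp (shift_mem_unitary _ _)).2⟩)
  ub := map_mem_unitary _ (Unitary.mem_iff.mpr
    ⟨Subtype.ext (Unitary.mem_iff.mp (shift_mem_unitary _ _)).1,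
      Subtype.ext (Unitary.mem_iff.mp (shift_mem_unitary _ _)).2⟩)
  uc := map_mem_unitary _ (Unitary.mem_iff.mpr
    ⟨Subtype.ext (Unitary.mem_iff.mp (shift_mem_unitary _ _)).1,
      Subtype.ext (Unitary.mem_iff.mp (shift_mem_unitary _ _)).2⟩)
  ud := map_mem_unitary _ (Unitary.mem_iff.mpr
    ⟨Subtype.ext (Unitary.mem_iff.mp (shift_mem_unitary _ _)).1,
      Subtype.ext (Unitary.mem_iff.mp (shift_mem_unitary _ _)).2⟩)
  ab := by
    have e : UlElem θ * VlElem θ = (lam θ : ℂ) • (VlElem θ * UlElem θ) :=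
      Subtype.ext (Ul_mul_Vl θ)
    rw [← map_mul, e, map_smul, map_mul]
  dc := by
    have e : VrElem θ * UrElem θ = (lam θ : ℂ) • (UrElem θ * VrElem θ) :=
      Subtype.ext (Vr_mul_Ur θ)
    rw [← map_mul, e, map_smul, map_mul]
  ac := T.pi_rho_commute _ _
  ad := T.pi_rho_commute _ _
  bc := T.pi_rho_commute _ _
  bd := T.pi_rho_commute _ _

/-- The representation `π̃_T` of `A_θ^(2)` on `K_T`: the continuous extension of
`π̃_T(a ⊗ c) = π_T(a) ρ_T(c)` from `A^fin`. -/
noncomputable def piTilde (T : NormalUCP (factor θ)) : Atheta2 θ →⋆ₐ[ℂ] (T.Space →L[ℂ] T.Space) :=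
  T.rotationRelations.rep

theorem piTilde_gen (T : NormalUCP (factor θ)) :
    piTilde T (Ul2Elem θ) = T.pi (UlElem θ) ∧ piTilde T (Vl2Elem θ) = T.pi (VlElem θ) ∧
    piTilde T (Ur2Elem θ) = T.rho (UrElem θ) ∧ piTilde T (Vr2Elem θ) = T.rho (VrElem θ) :=
  ⟨T.rotationRelations.rep_Ul2, T.rotationRelations.rep_Vl2, T.rotationRelations.rep_Ur2,
    T.rotationRelations.rep_Vr2⟩

/-- The linear functional `x ↦ ⟨k, π(x) k⟩`. -/
noncomputable def vectorFunctional {B : Type*} [Semiring B] [StarRing B] [Algebra ℂ B]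
    {K : Type*} [NormedAddCommGroup K] [InnerProductSpace ℂ K] [CompleteSpace K]
    (π : B →⋆ₐ[ℂ] (K →L[ℂ] K)) (k : K) : B →ₗ[ℂ] ℂ where
  toFun x := ⟪k, π x k⟫_ℂ
  map_add' x y := by rw [map_add, add_apply, inner_add_right]
  map_smul' c x := by rw [map_smul, smul_apply, inner_smul_right]; rfl

theorem vectorFunctional_star_mul_self_nonneg {B : Type*} [Semiring B] [StarRing B] [Algebra ℂ B]
    {K : Type*} [NormedAddCommGroup K] [InnerProductSpace ℂ K] [CompleteSpace K]
    (π : B →⋆ₐ[ℂ] (K →L[ℂ] K)) (k : K) (y : B) : 0 ≤ vectorFunctional π k (star y * y) := by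
  change 0 ≤ ⟪k, π (star y * y) k⟫_ℂ
  rw [map_mul, map_star, mul_apply_eq_comp, star_eq_adjoint, adjoint_inner_right]
  exact RCLike.nonneg_iff.mpr ⟨inner_self_nonneg, inner_self_im _⟩

/-- The state `ψ_T` of `A_θ^(2)`: `ψ_T(x) = ⟨ξ_T 1, π̃_T(x) ξ_T 1⟩`. -/
noncomputable def psi (T : NormalUCP (factor θ)) : Atheta2 θ →ₚ[ℂ] ℂ :=
  PositiveLinearMap.mk₀ (vectorFunctional (piTilde T) (T.xi vacuum)) fun x hx => by
    obtain ⟨y, rfl⟩ := CStarAlgebra.nonneg_iff_eq_star_mul_self.mp hx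
    exact vectorFunctional_star_mul_self_nonneg _ _ y

theorem psi_apply (T : NormalUCP (factor θ)) (x : Atheta2 θ) :
    psi T x = ⟪T.xi vacuum, piTilde T x (T.xi vacuum)⟫_ℂ := rfl

/-- `ψ_T` is a state. -/
theorem psi_one (T : NormalUCP (factor θ)) : psi T 1 = 1 := by
  rw [psi_apply, map_one, one_apply_eq_self, NormalUCP.xi_apply, T.inner_tmul, star_one, one_mul,
    T.op_one, one_apply_eq_self, inner_self_eq_norm_sq_to_K, vacuum, delta,
    lp.norm_single (by norm_num)]
  simp

/-- Two `*`-representations are unitarily equivalent. -/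
def UnitarilyEquivalent {B : Type*} [Semiring B] [StarRing B] [Algebra ℂ B]
    {K₁ : Type*} [NormedAddCommGroup K₁] [InnerProductSpace ℂ K₁] [CompleteSpace K₁]
    {K₂ : Type*} [NormedAddCommGroup K₂] [InnerProductSpace ℂ K₂] [CompleteSpace K₂]
    (π₁ : B →⋆ₐ[ℂ] (K₁ →L[ℂ] K₁)) (π₂ : B →⋆ₐ[ℂ] (K₂ →L[ℂ] K₂)) : Prop :=
  ∃ W : K₁ ≃ₗᵢ[ℂ] K₂, ∀ x k, W (π₁ x k) = π₂ x (W k)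

end GNS

end CPMaps

/-! All four conditions compare one object, the space `K_T` with its commuting actions `π_T` of A
and `ρ_T` of A', in different packaging. Condition (iv) on the algebraic tensor product is the hub
for (i) and (iii), and (ii) is tied to (iii).

Bimodules and (iv), valid for every von Neumann algebra M. For R, Q in `E_T` one has ⟨R h, Q k⟩ =
⟨h, R⋆Q k⟩, and the vectors R h are total in `K_T`. Hence an isomorphism Φ of bimodules produces a
unitary W with W(R h) = Φ(R) h, and W intertwines both actions. Conversely, R ↦ W R should carry
`E_T` onto `E_S`. This requires recognising `E_T` from `ρ_T` alone: it consists of all R with R c =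
`ρ_T(c)` R for c in the commutant (`mem_bimodule_iff`). The proof amplifies to finite tuples, as in
the double commutant theorem. The projection onto the closure of M·(hᵢ) has matrix entries in M',
and applying `ρ_T` to these entries gives the projection onto the closure of {(X hᵢ)}, X in the span
of `π_T(M) ξ_T M`. An intertwiner R therefore sends (hᵢ) into that closure, which is strong
approximation.

(iii) and (iv). The restrictions to the generators determine `π̃_T` on `A_θ^(2)`, so (iv) gives
(iii). For the converse, a unitary that intertwines the polynomials in the generators has to
intertwine all of A and A'. An element of A commutes with the right shifts, which makes its matrix
in the basis δ a twisted Toeplitz matrix. Its Fejér means are polynomials in U, V, their norms are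
bounded because the Fejér kernel is an average of compressions (`norm_schur_le`), and they converge
weakly because squares are Følner sets in ℤ². The representations `π_T` and `ρ_T` preserve bounded
weak limits of sequences, the first because T is normal. The argument for A' is symmetric.

(ii) and (iii). The vector `ξ_T 1` is cyclic for `π̃_T`: the right shifts move it to every `ξ_T
δ_g`, and weak limits of left polynomials yield all a ⊗ h. Uniqueness of the GNS construction
identifies `π̃_T` with the GNS representation of `ψ_T`. -/

namespace CPMaps

/-! ### Total families of vectors: unitaries and weak limits -/

section Hilbert

variable {K : Type*} [NormedAddCommGroup K] [InnerProductSpace ℂ K]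
variable {K₁ : Type*} [NormedAddCommGroup K₁] [InnerProductSpace ℂ K₁] [CompleteSpace K₁]
variable {K₂ : Type*} [NormedAddCommGroup K₂] [InnerProductSpace ℂ K₂] [CompleteSpace K₂]

theorem inner_linearCombination {I : Type*} (u : I → K) (x : I →₀ ℂ) :
    ⟪Finsupp.linearCombination ℂ u x, Finsupp.linearCombination ℂ u x⟫_ℂ =
      x.sum fun i r => x.sum fun j s => star r * s * ⟪u i, u j⟫_ℂ := by
  simp only [Finsupp.linearCombination_apply, Finsupp.sum, sum_inner, inner_sum, inner_smul_left,
    inner_smul_right, Complex.star_def, Finset.mul_sum]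
  rw [Finset.sum_comm]
  exact Finset.sum_congr rfl fun i _ => Finset.sum_congr rfl fun j _ => by ring

/-- Two total families of vectors with the same Gram matrix differ by a unitary. -/
theorem exists_linearIsometryEquiv_of_inner_eq {I : Type*} (u : I → K₁) (v : I → K₂)
    (hu : Dense (Submodule.span ℂ (Set.range u) : Set K₁))
    (hv : Dense (Submodule.span ℂ (Set.range v) : Set K₂))
    (h : ∀ i j, ⟪v i, v j⟫_ℂ = ⟪u i, u j⟫_ℂ) : ∃ W : K₁ ≃ₗᵢ[ℂ] K₂, ∀ i, W (u i) = v i := by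
  have hu' : DenseRange (Finsupp.linearCombination ℂ u) := by
    rw [← Finsupp.range_linearCombination] at hu; exact hu
  have hv' : DenseRange (Finsupp.linearCombination ℂ v) := by
    rw [← Finsupp.range_linearCombination] at hv; exact hv
  -- Equal Gram matrices give equal norms of the two combinations with the same coefficients. Thus
  -- the identity on coefficients descends to the spans, even if the families are linearly
  -- dependent, and extends to the completions.
  have hn : ∀ x : I →₀ ℂ, ‖Finsupp.linearCombination ℂ v (LinearEquiv.refl ℂ _ x)‖ =
      ‖Finsupp.linearCombination ℂ u x‖ := by
    intro x
    rw [norm_eq_sqrt_re_inner (𝕜 := ℂ), norm_eq_sqrt_re_inner (𝕜 := ℂ), LinearEquiv.refl_apply,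
      inner_linearCombination, inner_linearCombination]
    simp only [h]
  refine ⟨(LinearEquiv.refl ℂ (I →₀ ℂ)).extendOfIsometry _ _ hu' hv' hn, fun i => ?_⟩
  have := LinearEquiv.extendOfIsometry_eq (LinearEquiv.refl ℂ (I →₀ ℂ)) _ _ hu' hv' hn
    (Finsupp.single i 1)
  simpa using this

/-- A bounded sequence of functionals that converges on a total set converges pointwise. -/
theorem tendsto_of_dense_span {φ : ℕ → K →L[ℂ] ℂ} {ψ : K →L[ℂ] ℂ} {C : ℝ} (hC : ∀ n, ‖φ n‖ ≤ C)
    {s : Set K} (hs : Dense (Submodule.span ℂ s : Set K))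
    (h : ∀ v ∈ s, Filter.Tendsto (fun n => φ n v) Filter.atTop (nhds (ψ v))) (v : K) :
    Filter.Tendsto (fun n => φ n v) Filter.atTop (nhds (ψ v)) := by
  have hspan : ∀ w ∈ Submodule.span ℂ s,
      Filter.Tendsto (fun n => φ n w) Filter.atTop (nhds (ψ w)) := by
    intro w hw
    induction hw using Submodule.span_induction with
    | mem x hx => exact h x hx
    | zero => simp
    | add x y _ _ hx hy => simpa using hx.add hy
    | smul c x _ hx => simpa using hx.const_mul c
  have hC0 : 0 ≤ C := (norm_nonneg _).trans (hC 0)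
  rw [Metric.tendsto_atTop]
  intro ε hε
  -- Replacing v by w costs at most (C + ‖ψ‖)‖w − v‖, uniformly in n. The radius makes this less
  -- than ε/2, and the summand 1 keeps the denominator positive.
  obtain ⟨w, hw, hvw⟩ := Metric.dense_iff.mp hs v (ε / (2 * (C + ‖ψ‖ + 1))) (by positivity)
  rw [Metric.mem_ball, dist_eq_norm] at hw
  obtain ⟨N, hN⟩ := Metric.tendsto_atTop.mp (hspan w hvw) (ε / 2) (by positivity)
  refine ⟨N, fun n hn => ?_⟩
  have h1 : φ n v - ψ v = (φ n w - ψ w) - (φ n (w - v) - ψ (w - v)) := by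
    simp only [map_sub]; ring
  have h2 : ‖φ n (w - v)‖ ≤ C * ‖w - v‖ := (φ n).le_of_opNorm_le (hC n) _
  have h3 : ‖ψ (w - v)‖ ≤ ‖ψ‖ * ‖w - v‖ := ψ.le_opNorm _
  have h4 := hN n hn
  rw [dist_eq_norm] at h4 ⊢
  have h5 : (C + ‖ψ‖ + 1) * ‖w - v‖ < ε / 2 := by
    have := mul_lt_mul_of_pos_left hw (by positivity : 0 < C + ‖ψ‖ + 1)
    refine this.trans_eq ?_
    field_simp
  rw [h1]
  have h6 := norm_sub_le (φ n w - ψ w) (φ n (w - v) - ψ (w - v))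
  have h7 := norm_sub_le (φ n (w - v)) (ψ (w - v))
  nlinarith [norm_nonneg (w - v)]

/-- Weak convergence of a bounded sequence of operators may be tested on a total set. -/
theorem tendsto_inner_of_dense_span [CompleteSpace K] {X : ℕ → K →L[ℂ] K} {Y : K →L[ℂ] K} {C : ℝ}
    (hC : ∀ n, ‖X n‖ ≤ C) {s : Set K} (hs : Dense (Submodule.span ℂ s : Set K))
    (h : ∀ u ∈ s, ∀ v ∈ s,
      Filter.Tendsto (fun n => ⟪u, X n v⟫_ℂ) Filter.atTop (nhds ⟪u, Y v⟫_ℂ)) (u v : K) :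
    Filter.Tendsto (fun n => ⟪u, X n v⟫_ℂ) Filter.atTop (nhds ⟪u, Y v⟫_ℂ) := by
  have h1 : ∀ u ∈ s, ∀ v, Filter.Tendsto (fun n => ⟪u, X n v⟫_ℂ) Filter.atTop
      (nhds ⟪u, Y v⟫_ℂ) := by
    intro u hu v
    refine tendsto_of_dense_span (φ := fun n => innerSL ℂ u ∘L X n) (ψ := innerSL ℂ u ∘L Y)
      (C := ‖u‖ * C) (fun n => ?_) hs (h u hu) v
    refine (opNorm_comp_le _ _).trans ?_
    rw [innerSL_apply_norm]
    exact mul_le_mul_of_nonneg_left (hC n) (norm_nonneg _)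
  -- With v now arbitrary, the other variable is freed from s. Conjugation puts it in the linear
  -- slot, so that the lemma on functionals applies a second time.
  have h2 : ∀ w, Filter.Tendsto (fun n => ⟪X n v, w⟫_ℂ) Filter.atTop (nhds ⟪Y v, w⟫_ℂ) := by
    intro w
    refine tendsto_of_dense_span (φ := fun n => innerSL ℂ (X n v)) (ψ := innerSL ℂ (Y v))
      (C := C * ‖v‖) (fun n => ?_) hs (fun u hu => ?_) w
    · rw [innerSL_apply_norm]
      exact (X n).le_of_opNorm_le (hC n) v
    · have := (Complex.continuous_conj.tendsto _).comp (h1 u hu v)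
      simpa [Function.comp_def] using this
  have := (Complex.continuous_conj.tendsto _).comp (h2 u)
  simpa [Function.comp_def] using this

end Hilbert

section Equivalence

variable {B : Type*} [Semiring B] [StarRing B] [Algebra ℂ B]
variable {K₁ : Type*} [NormedAddCommGroup K₁] [InnerProductSpace ℂ K₁] [CompleteSpace K₁]
variable {K₂ : Type*} [NormedAddCommGroup K₂] [InnerProductSpace ℂ K₂] [CompleteSpace K₂]
variable {K₃ : Type*} [NormedAddCommGroup K₃] [InnerProductSpace ℂ K₃] [CompleteSpace K₃]
variable {π₁ : B →⋆ₐ[ℂ] (K₁ →L[ℂ] K₁)} {π₂ : B →⋆ₐ[ℂ] (K₂ →L[ℂ] K₂)}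
  {π₃ : B →⋆ₐ[ℂ] (K₃ →L[ℂ] K₃)}

theorem UnitarilyEquivalent.symm (h : UnitarilyEquivalent π₁ π₂) : UnitarilyEquivalent π₂ π₁ := by
  obtain ⟨W, hW⟩ := h
  refine ⟨W.symm, fun x k => ?_⟩
  rw [LinearIsometryEquiv.symm_apply_eq, hW, LinearIsometryEquiv.apply_symm_apply]

theorem UnitarilyEquivalent.trans (h : UnitarilyEquivalent π₁ π₂) (h' : UnitarilyEquivalent π₂ π₃) :
    UnitarilyEquivalent π₁ π₃ := by
  obtain ⟨W, hW⟩ := h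
  obtain ⟨W', hW'⟩ := h'
  refine ⟨W.trans W', fun x k => ?_⟩
  rw [LinearIsometryEquiv.trans_apply, hW, hW', LinearIsometryEquiv.trans_apply]

end Equivalence

/-! ### From isomorphisms of bimodules to unitaries of Stinespring spaces -/

section Bimodule

variable {H : Type*} [NormedAddCommGroup H] [InnerProductSpace ℂ H] [CompleteSpace H]
variable {M : VonNeumannAlgebra H}

namespace NormalUCP

theorem dense_span_tmul (T : NormalUCP M) :
    Dense (Submodule.span ℂ {x : T.Space | ∃ a h, x = T.tmul a h} : Set T.Space) := by
  intro z
  induction z using UniformSpace.Completion.induction_on with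
  | hp => exact isClosed_closure
  | ih x =>
    refine subset_closure ?_
    induction x using PreStinespring.induction with
    | zero => rw [UniformSpace.Completion.coe_zero]; exact Submodule.zero_mem _
    | add x y hx hy => rw [UniformSpace.Completion.coe_add]; exact Submodule.add_mem _ hx hy
    | tmul a k => exact Submodule.subset_span ⟨a, k, rfl⟩

theorem pi_comp_xi_comp_mem (T : NormalUCP M) (a b : Elem M) :
    T.pi a ∘L T.xi ∘L (b : H →L[ℂ] H) ∈ T.algBimodule := Submodule.subset_span ⟨a, b, rfl⟩

theorem pi_comp_xi_mem (T : NormalUCP M) (a : Elem M) : T.pi a ∘L T.xi ∈ T.algBimodule := by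
  have := T.pi_comp_xi_comp_mem a 1
  exact this

theorem pi_xi_apply (T : NormalUCP M) (a : Elem M) (h : H) : T.pi a (T.xi h) = T.tmul a h := by
  rw [xi_apply, pi_tmul, mul_one]

/-- Both factors are unital, so a ⊗ 1 and 1 ⊗ c recover the two actions separately. This is the form
in which condition (iv) is used throughout. -/
theorem unitarilyEquivalent_piTildeAlg_iff {T S : NormalUCP M} :
    UnitarilyEquivalent T.piTildeAlg S.piTildeAlg ↔ ∃ W : T.Space ≃ₗᵢ[ℂ] S.Space,
      (∀ a k, W (T.pi a k) = S.pi a (W k)) ∧ (∀ c k, W (T.rho c k) = S.rho c (W k)) := by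
  constructor
  · rintro ⟨W, hW⟩
    refine ⟨W, fun a k => ?_, fun c k => ?_⟩
    · simpa [piTildeAlg_tmul] using hW (a ⊗ₜ 1) k
    · simpa [piTildeAlg_tmul] using hW (1 ⊗ₜ c) k
  · rintro ⟨W, h1, h2⟩
    refine ⟨W, fun x k => ?_⟩
    induction x using TensorProduct.induction_on with
    | zero => simp
    | add x y hx hy => simp only [map_add, add_apply, hx, hy]
    | tmul a c => rw [piTildeAlg_tmul, piTildeAlg_tmul, mul_apply_eq_comp, mul_apply_eq_comp, h1, h2]

theorem dense_span_bimodule_apply (T : NormalUCP M) :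
    Dense (Submodule.span ℂ (Set.range fun p : T.bimodule × H =>
      (p.1 : H →L[ℂ] T.Space) p.2) : Set T.Space) := by
  refine T.dense_span_tmul.mono (Submodule.span_mono ?_)
  rintro _ ⟨a, h, rfl⟩
  exact ⟨(⟨_, T.algBimodule_le (T.pi_comp_xi_mem a)⟩, h), T.pi_xi_apply a h⟩

/-- The Gram matrix of the total family R h depends only on the operator-valued inner product. This
is why an isomorphism of bimodules defines an isometry. -/
theorem inner_bimodule_apply (T : NormalUCP M) (R Q : T.bimodule) (h k : H) :
    ⟪(R : H →L[ℂ] T.Space) h, (Q : H →L[ℂ] T.Space) k⟫_ℂ =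
      ⟪h, (T.innerMod R Q : H →L[ℂ] H) k⟫_ℂ := by
  change _ = ⟪h, adjoint (R : H →L[ℂ] T.Space) ((Q : H →L[ℂ] T.Space) k)⟫_ℂ
  rw [adjoint_inner_right]

/-- An isomorphism of the KSGNS bimodules induces a unitary between the Stinespring spaces. -/
theorem KSGNSEquivalent.unitarilyEquivalent {T S : NormalUCP M} (h : KSGNSEquivalent T S) :
    UnitarilyEquivalent T.piTildeAlg S.piTildeAlg := by
  obtain ⟨Φ, h1, h2, -⟩ := h
  obtain ⟨W, hW⟩ := exists_linearIsometryEquiv_of_inner_eq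
    (fun p : T.bimodule × H => (p.1 : H →L[ℂ] T.Space) p.2)
    (fun p : T.bimodule × H => (Φ p.1 : H →L[ℂ] S.Space) p.2) T.dense_span_bimodule_apply
    (by
      -- Surjectivity of Φ makes the second family total.
      refine S.dense_span_bimodule_apply.mono (Submodule.span_mono ?_)
      rintro _ ⟨⟨R, k⟩, rfl⟩
      exact ⟨(Φ.symm R, k), by simp⟩)
    (by
      rintro ⟨R, k⟩ ⟨Q, l⟩
      simp only [inner_bimodule_apply, h1])
  have hWR : ∀ (R : T.bimodule) k, W ((R : H →L[ℂ] T.Space) k) = (Φ R : H →L[ℂ] S.Space) k :=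
    fun R k => hW (R, k)
  let W' : T.Space →L[ℂ] S.Space := W.toLinearIsometry.toContinuousLinearMap
  refine unitarilyEquivalent_piTildeAlg_iff.mpr ⟨W, fun a k => ?_, fun c k => ?_⟩
  · suffices e : W' ∘L T.pi a = S.pi a ∘L W' from congrArg (fun X => X k) e
    refine ext_on T.dense_span_bimodule_apply ?_
    rintro _ ⟨⟨R, l⟩, rfl⟩
    change W ((T.leftMul a R : H →L[ℂ] T.Space) l) = S.pi a (W ((R : H →L[ℂ] T.Space) l))
    rw [hWR, hWR, h2]
    rfl
  · suffices e : W' ∘L T.rho c = S.rho c ∘L W' from congrArg (fun X => X k) e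
    refine ext_on T.dense_span_bimodule_apply ?_
    rintro _ ⟨⟨R, l⟩, rfl⟩
    change W (T.rho c ((R : H →L[ℂ] T.Space) l)) = S.rho c (W ((R : H →L[ℂ] T.Space) l))
    rw [← T.rho_bimodule c R.2, hWR, hWR, ← S.rho_bimodule c (Φ R).2]

end NormalUCP

end Bimodule

/-! ### Amplification to tuples, and the bimodule as a space of intertwiners -/

section Diag

variable {ι : Type*}
variable {H : Type*} [NormedAddCommGroup H] [InnerProductSpace ℂ H]
variable {K : Type*} [NormedAddCommGroup K] [InnerProductSpace ℂ K]
variable {L : Type*} [NormedAddCommGroup L] [InnerProductSpace ℂ L]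

/-- The operator on `ι`-tuples of vectors that has the matrix `X`. -/
noncomputable def matrixOp [Fintype ι] (X : ι → ι → H →L[ℂ] K) :
    PiLp 2 (fun _ : ι => H) →L[ℂ] PiLp 2 (fun _ : ι => K) :=
  ((PiLp.continuousLinearEquiv 2 ℂ (fun _ : ι => K)).symm : (ι → K) →L[ℂ] _) ∘L
    ContinuousLinearMap.pi (fun i => ∑ j, X i j ∘L PiLp.proj 2 (fun _ : ι => H) j)

theorem matrixOp_apply [Fintype ι] (X : ι → ι → H →L[ℂ] K) (v : PiLp 2 (fun _ : ι => H)) (i : ι) :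
    matrixOp X v i = ∑ j, X i j (v j) := by
  simp [matrixOp]

/-- The operator `X` applied to each entry of an `ι`-tuple of vectors. -/
noncomputable def diagOp (X : H →L[ℂ] K) :
    PiLp 2 (fun _ : ι => H) →L[ℂ] PiLp 2 (fun _ : ι => K) :=
  ((PiLp.continuousLinearEquiv 2 ℂ (fun _ : ι => K)).symm : (ι → K) →L[ℂ] _) ∘L
    ContinuousLinearMap.pi (fun i => X ∘L PiLp.proj 2 (fun _ : ι => H) i)

@[simp]
theorem diagOp_apply (X : H →L[ℂ] K) (v : PiLp 2 (fun _ : ι => H)) (i : ι) :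
    diagOp X v i = X (v i) := rfl

theorem inner_diagOp [Fintype ι] [CompleteSpace H] [CompleteSpace K] (X : H →L[ℂ] K)
    (v : PiLp 2 (fun _ : ι => H)) (w : PiLp 2 (fun _ : ι => K)) :
    ⟪diagOp X v, w⟫_ℂ = ⟪v, diagOp (adjoint X) w⟫_ℂ := by
  simp [PiLp.inner_apply, adjoint_inner_right]

/-- The map `X ↦ (X hᵢ)ᵢ`. -/
noncomputable def diagEval (h : PiLp 2 (fun _ : ι => H)) :
    (H →L[ℂ] K) →ₗ[ℂ] PiLp 2 (fun _ : ι => K) where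
  toFun X := diagOp X h
  map_add' _ _ := rfl
  map_smul' _ _ := rfl

theorem inner_eq_zero_of_mem_topologicalClosure {V : Submodule ℂ H} {u w : H}
    (h : ∀ x ∈ V, ⟪u, x⟫_ℂ = 0) (hw : w ∈ V.topologicalClosure) : ⟪u, w⟫_ℂ = 0 := by
  have hcl : IsClosed {x : H | ⟪u, x⟫_ℂ = 0} := isClosed_eq (by fun_prop) continuous_const
  exact closure_minimal (fun x hx => h x hx) hcl hw

end Diag

section Bimodule

variable {H : Type*} [NormedAddCommGroup H] [InnerProductSpace ℂ H] [CompleteSpace H]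
variable {M : VonNeumannAlgebra H} {ι : Type*} [Fintype ι]

/-- The cyclic subspace `closure {(a hᵢ)ᵢ | a ∈ M}`. -/
noncomputable def cyclicSubspace (M : VonNeumannAlgebra H) (h : PiLp 2 (fun _ : ι => H)) :
    Submodule ℂ (PiLp 2 (fun _ : ι => H)) :=
  (M.toStarSubalgebra.toSubalgebra.toSubmodule.map
    (diagEval (K := H) h)).topologicalClosure

instance (h : PiLp 2 (fun _ : ι => H)) : CompleteSpace (cyclicSubspace M h) :=
  (Submodule.isClosed_topologicalClosure _).completeSpace_coe

theorem mem_cyclicSubspace_self (h : PiLp 2 (fun _ : ι => H)) : h ∈ cyclicSubspace M h :=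
  subset_closure ⟨1, one_mem M.toStarSubalgebra, rfl⟩

theorem diagOp_mem_cyclicSubspace (a : Elem M) {h v : PiLp 2 (fun _ : ι => H)}
    (hv : v ∈ cyclicSubspace M h) : diagOp (a : H →L[ℂ] H) v ∈ cyclicSubspace M h := by
  refine map_mem_closure (diagOp (a : H →L[ℂ] H)).continuous hv ?_
  rintro _ ⟨b, hb, rfl⟩
  exact ⟨a * b, (a * (⟨b, hb⟩ : Elem M)).2, rfl⟩

/-- The cyclic subspace is invariant under a and under `star a`, hence reduces the diagonal action
of M. -/
theorem cyclicProjection_diagOp (a : Elem M) (h v : PiLp 2 (fun _ : ι => H)) :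
    (cyclicSubspace M h).starProjection (diagOp (a : H →L[ℂ] H) v) =
      diagOp (a : H →L[ℂ] H) ((cyclicSubspace M h).starProjection v) := by
  refine Submodule.eq_starProjection_of_mem_of_inner_eq_zero
    (diagOp_mem_cyclicSubspace a (Submodule.starProjection_apply_mem _ _)) fun w hw => ?_
  rw [← map_sub, inner_diagOp]
  exact Submodule.starProjection_inner_eq_zero _ _
    (diagOp_mem_cyclicSubspace (star a) hw)

/-- The matrix entries of the projection onto a cyclic subspace lie in the commutant. -/
theorem exists_matrix_cyclicProjection (M : VonNeumannAlgebra H) (h : PiLp 2 (fun _ : ι => H)) :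
    ∃ c : ι → ι → Elem M.commutant, ∀ v i,
      (cyclicSubspace M h).starProjection v i = ∑ j, (c i j : H →L[ℂ] H) (v j) := by
  classical
  let P := (cyclicSubspace M h).starProjection
  let s : ι → H →L[ℂ] PiLp 2 (fun _ : ι => H) := fun j =>
    ((PiLp.continuousLinearEquiv 2 ℂ (fun _ : ι => H)).symm : (ι → H) →L[ℂ] _) ∘L
      ContinuousLinearMap.single ℂ (fun _ : ι => H) j
  have hs : ∀ j k, s j k = WithLp.toLp 2 (Pi.single j k) := fun _ _ => rfl
  -- These are the matrix entries of the projection. As it commutes with every diagonal operator of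
  -- M, each entry commutes with M.
  let c : ι → ι → H →L[ℂ] H := fun i j => PiLp.proj 2 (fun _ : ι => H) i ∘L P ∘L s j
  have hc : ∀ i j, c i j ∈ M.commutant := by
    intro i j
    refine VonNeumannAlgebra.mem_commutant_iff.mpr fun a ha => ?_
    ext k
    have h1 := congrArg (fun v : PiLp 2 (fun _ : ι => H) => v i)
      (cyclicProjection_diagOp ⟨a, ha⟩ h (s j k))
    have h2 : diagOp a (s j k) = s j (a k) := by
      ext l
      by_cases hl : l = j
      · subst hl; simp [hs]
      · simp [hs, hl]
    rw [h2] at h1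
    exact h1.symm
  refine ⟨fun i j => ⟨c i j, hc i j⟩, fun v i => ?_⟩
  have hv : v = ∑ j, s j (v j) := by
    ext i
    simp [hs, Finset.sum_apply, Pi.single_apply]
  conv_lhs => rw [hv]
  rw [map_sum]
  simp [c, P]

namespace NormalUCP

variable (T : NormalUCP M)

/-- The subspace `closure {(X hᵢ)ᵢ | X ∈ span π_T(M) ξ_T M}`. -/
noncomputable def bimoduleSubspace (h : PiLp 2 (fun _ : ι => H)) :
    Submodule ℂ (PiLp 2 (fun _ : ι => T.Space)) :=
  (T.algBimodule.map (diagEval h)).topologicalClosure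

instance (h : PiLp 2 (fun _ : ι => H)) : CompleteSpace (T.bimoduleSubspace h) :=
  (Submodule.isClosed_topologicalClosure _).completeSpace_coe

theorem algBimodule_comp_mem {X : H →L[ℂ] T.Space} (hX : X ∈ T.algBimodule) (b : Elem M) :
    X ∘L (b : H →L[ℂ] H) ∈ T.algBimodule := by
  induction hX using Submodule.span_induction with
  | zero => simp
  | add X Y _ _ hX hY => rw [add_comp]; exact add_mem hX hY
  | smul c X _ hX => rw [smul_comp]; exact Submodule.smul_mem _ c hX
  | mem X hX =>
    obtain ⟨a, d, rfl⟩ := hX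
    exact Submodule.subset_span ⟨a, d * b, rfl⟩

/-- X sends the cyclic subspace into the bimodule subspace because the span is stable under right
multiplication by M. It sends the orthogonal complement to the orthogonal complement because X⋆Y
lies in M for every Y in the span. -/
theorem bimoduleProjection_diagOp {X : H →L[ℂ] T.Space} (hX : X ∈ T.algBimodule)
    (h v : PiLp 2 (fun _ : ι => H)) :
    (T.bimoduleSubspace h).starProjection (diagOp X v) =
      diagOp X ((cyclicSubspace M h).starProjection v) := by
  have hmem : ∀ w ∈ cyclicSubspace M h, diagOp X w ∈ T.bimoduleSubspace h := by
    intro w hw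
    refine map_mem_closure (diagOp X).continuous hw ?_
    rintro _ ⟨b, hb, rfl⟩
    exact ⟨X ∘L b, T.algBimodule_comp_mem hX ⟨b, hb⟩, rfl⟩
  refine Submodule.eq_starProjection_of_mem_of_inner_eq_zero
    (hmem _ (Submodule.starProjection_apply_mem _ _)) fun w hw => ?_
  rw [← map_sub]
  refine inner_eq_zero_of_mem_topologicalClosure ?_ hw
  rintro _ ⟨Y, hY, rfl⟩
  rw [inner_diagOp]
  refine Submodule.starProjection_inner_eq_zero _ _ (subset_closure ?_)
  -- The element of M that puts X⋆Y h into the cyclic subspace is the inner product X⋆Y itself.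
  exact ⟨_, (T.innerMod ⟨X, T.algBimodule_le hX⟩ ⟨Y, T.algBimodule_le hY⟩).2, rfl⟩

/-- An intertwiner of the actions of the commutant maps `(hᵢ)ᵢ` into the closure of
`{(X hᵢ)ᵢ | X ∈ span π_T(M) ξ_T M}`. -/
theorem diagOp_mem_bimoduleSubspace {R : H →L[ℂ] T.Space}
    (hR : ∀ (c : Elem M.commutant) k, R ((c : H →L[ℂ] H) k) = T.rho c (R k))
    (h : PiLp 2 (fun _ : ι => H)) : diagOp R h ∈ T.bimoduleSubspace h := by
  classical
  obtain ⟨c, hc⟩ := exists_matrix_cyclicProjection M h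
  let D : PiLp 2 (fun _ : ι => T.Space) →L[ℂ] PiLp 2 (fun _ : ι => T.Space) :=
    matrixOp fun i j => T.rho (c i j)
  -- An intertwiner X turns each matrix entry cᵢⱼ of the cyclic projection into `ρ_T(cᵢⱼ)`, so D
  -- corresponds to that projection through X.
  have hD : ∀ X : H →L[ℂ] T.Space,
      (∀ (c : Elem M.commutant) k, X ((c : H →L[ℂ] H) k) = T.rho c (X k)) →
      ∀ v : PiLp 2 (fun _ : ι => H),
        D (diagOp X v) = diagOp X ((cyclicSubspace M h).starProjection v) := by
    intro X hX v
    ext i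
    rw [matrixOp_apply, diagOp_apply, hc, map_sum]
    exact Finset.sum_congr rfl fun j _ => (hX _ _).symm
  -- D and the projection onto the bimodule subspace agree on the tuples with a single nonzero entry
  -- a ⊗ k, where both follow the cyclic projection through X = `π_T(a) ξ_T`. Such tuples are total.
  have hP : ∀ w, D w = (T.bimoduleSubspace h).starProjection w := by
    intro w
    have h1 : ∀ j, ∀ z : T.Space, D (WithLp.toLp 2 (Pi.single j z)) =
        (T.bimoduleSubspace h).starProjection (WithLp.toLp 2 (Pi.single j z)) := by
      intro j z
      let s : T.Space →L[ℂ] PiLp 2 (fun _ : ι => T.Space) :=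
        ((PiLp.continuousLinearEquiv 2 ℂ (fun _ : ι => T.Space)).symm : (ι → T.Space) →L[ℂ] _) ∘L
          ContinuousLinearMap.single ℂ (fun _ : ι => T.Space) j
      suffices e : D ∘L s = (T.bimoduleSubspace h).starProjection ∘L s from
        congrArg (fun X => X z) e
      refine T.ext_tmul fun a k => ?_
      have h2 : s (T.tmul a k) =
          diagOp (T.pi a ∘L T.xi) (WithLp.toLp 2 (Pi.single j k)) := by
        ext l
        by_cases hl : l = j
        · subst hl; simp [s, pi_xi_apply]
        · simp [s, hl]
      change D (s _) = (T.bimoduleSubspace h).starProjection (s _)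
      rw [h2, T.bimoduleProjection_diagOp (T.pi_comp_xi_mem a)]
      exact hD _ (fun c k => T.rho_bimodule c (T.algBimodule_le (T.pi_comp_xi_mem a)) k) _
    have hw : w = ∑ j, WithLp.toLp 2 (Pi.single j (w j)) := by
      ext i
      simp [Finset.sum_apply, Pi.single_apply]
    rw [hw, map_sum, map_sum]
    exact Finset.sum_congr rfl fun j _ => h1 j _
  -- The relation for D holds for the given intertwiner R as well. Since h lies in its own cyclic
  -- subspace, the projection fixes (R hᵢ).
  have h3 := hP (diagOp R h)
  rw [hD R hR, Submodule.starProjection_eq_self_iff.mpr (mem_cyclicSubspace_self h)] at h3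
  exact Submodule.starProjection_eq_self_iff.mp h3.symm

/-- The KSGNS bimodule consists of all the intertwiners of the actions of the commutant. -/
theorem mem_bimodule_iff {R : H →L[ℂ] T.Space} :
    R ∈ T.bimodule ↔ ∀ (c : Elem M.commutant) k, R ((c : H →L[ℂ] H) k) = T.rho c (R k) := by
  refine ⟨fun hR c k => T.rho_bimodule c hR k, fun hR => ?_⟩
  rw [mem_bimodule, mem_closure_iff_nhds]
  intro t ht
  rw [nhds_pi, Filter.mem_pi] at ht
  obtain ⟨I, hI, u, hu, hut⟩ := ht
  have := hI.fintype
  -- A basic neighbourhood for pointwise convergence constrains R at the finitely many vectors of I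
  -- only. The tuple is taken to be I indexed by itself.
  have h1 := T.diagOp_mem_bimoduleSubspace hR (WithLp.toLp 2 fun i : I => (i : H))
  have h2 : {w : PiLp 2 (fun _ : I => T.Space) | ∀ i : I, w i ∈ u i} ∈
      nhds (diagOp R (WithLp.toLp 2 fun i : I => (i : H))) := by
    refine Filter.eventually_all.mpr fun i => ?_
    exact (PiLp.continuous_apply 2 _ i).continuousAt.eventually_mem (hu i)
  obtain ⟨_, hw, X, hX, rfl⟩ := mem_closure_iff_nhds.mp h1 _ h2
  exact ⟨X, hut fun i hi => hw ⟨i, hi⟩, X, hX, rfl⟩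

/-- A unitary intertwining the representations of the commutant maps the KSGNS bimodule to the
KSGNS bimodule. -/
theorem comp_bimodule_mem {T S : NormalUCP M} (W : T.Space ≃ₗᵢ[ℂ] S.Space)
    (hW : ∀ c k, W (T.rho c k) = S.rho c (W k)) {R : H →L[ℂ] T.Space} (hR : R ∈ T.bimodule) :
    W.toLinearIsometry.toContinuousLinearMap ∘L R ∈ S.bimodule := by
  refine S.mem_bimodule_iff.mpr fun c k => ?_
  change W (R _) = S.rho c (W (R k))
  rw [T.rho_bimodule c hR, hW]

/-- A unitary equivalence of the representations `π̃_T` induces an isomorphism of the KSGNS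
bimodules. -/
theorem KSGNSEquivalent.of_unitarilyEquivalent {T S : NormalUCP M}
    (h : UnitarilyEquivalent T.piTildeAlg S.piTildeAlg) : KSGNSEquivalent T S := by
  obtain ⟨W, hpi, hrho⟩ := unitarilyEquivalent_piTildeAlg_iff.mp h
  have hrho' : ∀ c k, W.symm (S.rho c k) = T.rho c (W.symm k) := by
    intro c k
    rw [LinearIsometryEquiv.symm_apply_eq, hrho, LinearIsometryEquiv.apply_symm_apply]
  refine ⟨{ toFun := fun R => ⟨_, comp_bimodule_mem W hrho R.2⟩
            invFun := fun R => ⟨_, comp_bimodule_mem W.symm hrho' R.2⟩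
            map_add' := fun R Q => Subtype.ext (comp_add _ _ _)
            map_smul' := fun c R => Subtype.ext (comp_smul _ _ _)
            left_inv := fun R => Subtype.ext (ext fun k => W.symm_apply_apply _)
            right_inv := fun R => Subtype.ext (ext fun k => W.apply_symm_apply _) },
    fun Q R => ?_, fun a R => ?_, fun R b => rfl⟩
  · refine Subtype.ext (ext fun k => ext_inner_left ℂ fun l => ?_)
    rw [← inner_bimodule_apply, ← inner_bimodule_apply]
    exact W.inner_map_map _ _
  · exact Subtype.ext (ext fun k => hpi a _)

theorem kSGNSEquivalent_iff {T S : NormalUCP M} :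
    KSGNSEquivalent T S ↔ UnitarilyEquivalent T.piTildeAlg S.piTildeAlg :=
  ⟨KSGNSEquivalent.unitarilyEquivalent, KSGNSEquivalent.of_unitarilyEquivalent⟩

end NormalUCP

end Bimodule

/-! ### Normality of the two representations along bounded weakly convergent sequences -/

section Normality

variable {H : Type*} [NormedAddCommGroup H] [InnerProductSpace ℂ H] [CompleteSpace H]
variable {M : VonNeumannAlgebra H}

/-- A bounded sequence of operators that converges in the weak operator topology. -/
structure BoundedWeakLimit {K : Type*} [NormedAddCommGroup K] [InnerProductSpace ℂ K]
    (X : ℕ → K →L[ℂ] K) (Y : K →L[ℂ] K) : Prop where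
  bounded : ∃ C, ∀ n, ‖X n‖ ≤ C
  tendsto : ∀ u v, Filter.Tendsto (fun n => ⟪u, X n v⟫_ℂ) Filter.atTop (nhds ⟪u, Y v⟫_ℂ)

/-- Vector functionals are the ones to pull back along T: they produce the matrix coefficients of
`π_T` between elementary tensors. -/
theorem isNormalFunctional_inner (h k : H) :
    IsNormalFunctional (fun a : Elem M => ⟪h, (a : H →L[ℂ] H) k⟫_ℂ) := by
  have hs : ∀ z : H, Summable fun n : ℕ => ‖if n = 0 then z else 0‖ ^ 2 := fun z =>
    summable_of_ne_finset_zero (s := {0}) fun n hn => by simp at hn; simp [hn]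
  refine ⟨fun n => if n = 0 then h else 0, fun n => if n = 0 then k else 0, hs h, hs k,
    fun a => ?_⟩
  have := hasSum_single (f := fun n : ℕ => ⟪if n = 0 then h else 0,
    (a : H →L[ℂ] H) (if n = 0 then k else 0)⟫_ℂ) 0 fun n hn => by simp [hn]
  simpa using this

/-- Normal functionals are continuous along bounded weakly convergent sequences. -/
theorem IsNormalFunctional.tendsto {φ : Elem M → ℂ} (hφ : IsNormalFunctional φ) {a : ℕ → Elem M}
    {b : Elem M}
    (h : BoundedWeakLimit (fun n => (a n : H →L[ℂ] H)) b) :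
    Filter.Tendsto (fun n => φ (a n)) Filter.atTop (nhds (φ b)) := by
  obtain ⟨x, y, hx, hy, hsum⟩ := hφ
  obtain ⟨C, hC⟩ := h.bounded
  have e : ∀ c, φ c = ∑' n, ⟪x n, (c : H →L[ℂ] H) (y n)⟫_ℂ := fun c => (hsum c).tsum_eq.symm
  simp only [e]
  -- The norm bound on the sequence supplies the summable majorant; without it, termwise weak
  -- convergence would not pass through the sum.
  refine tendsto_tsum_of_dominated_convergence
    (bound := fun n => C * (‖x n‖ ^ 2 + ‖y n‖ ^ 2)) ((hx.add hy).mul_left C)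
    (fun k => h.tendsto _ _) (Filter.Eventually.of_forall fun n k => ?_)
  have hC0 : 0 ≤ C := (norm_nonneg _).trans (hC 0)
  calc ‖⟪x k, (a n : H →L[ℂ] H) (y k)⟫_ℂ‖ ≤ ‖x k‖ * ‖(a n : H →L[ℂ] H) (y k)‖ := norm_inner_le_norm _ _
    _ ≤ ‖x k‖ * (C * ‖y k‖) := by
        gcongr
        exact (a n : H →L[ℂ] H).le_of_opNorm_le (hC n) _
    _ = C * (‖x k‖ * ‖y k‖) := by ring
    _ ≤ _ := by
        gcongr
        nlinarith [sq_nonneg (‖x k‖ - ‖y k‖), sq_nonneg ‖x k‖, sq_nonneg ‖y k‖]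

namespace NormalUCP

variable (T : NormalUCP M)

/-- The Stinespring representation `π_T` is normal. -/
theorem boundedWeakLimit_pi {a : ℕ → Elem M} {b : Elem M}
    (h : BoundedWeakLimit (fun n => (a n : H →L[ℂ] H)) b) :
    BoundedWeakLimit (fun n => T.pi (a n)) (T.pi b) := by
  obtain ⟨C, hC⟩ := h.bounded
  have hbd : ∀ n, ‖T.pi (a n)‖ ≤ C := fun n => (NonUnitalStarAlgHom.norm_apply_le T.pi _).trans (hC n)
  refine ⟨⟨C, hbd⟩, tendsto_inner_of_dense_span hbd T.dense_span_tmul ?_⟩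
  rintro _ ⟨c, h', rfl⟩ _ ⟨d, k, rfl⟩
  simp only [pi_tmul, T.inner_tmul]
  -- The coefficient between c ⊗ h' and d ⊗ k is ⟨h', T(c⋆ a d) k⟩, a normal functional of c⋆ a d by
  -- normality of T. The sequence c⋆ aₙ d is again bounded and weakly convergent.
  refine (T.normal _ (isNormalFunctional_inner h' k)).tendsto
    (a := fun n => star c * (a n * d)) (b := star c * (b * d)) ⟨⟨‖star c‖ * (C * ‖d‖), fun n => ?_⟩,
      fun u v => ?_⟩
  · refine (norm_mul_le (star c) (a n * d)).trans ?_
    refine mul_le_mul_of_nonneg_left ((norm_mul_le (a n) d).trans ?_) (norm_nonneg _)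
    exact mul_le_mul_of_nonneg_right (hC n) (norm_nonneg _)
  · have := h.tendsto ((c : H →L[ℂ] H) u) ((d : H →L[ℂ] H) v)
    simpa [star_eq_adjoint, adjoint_inner_right] using this

/-- The representation `ρ_T` of the commutant is normal. -/
theorem boundedWeakLimit_rho {a : ℕ → Elem M.commutant} {b : Elem M.commutant}
    (h : BoundedWeakLimit (fun n => (a n : H →L[ℂ] H)) b) :
    BoundedWeakLimit (fun n => T.rho (a n)) (T.rho b) := by
  obtain ⟨C, hC⟩ := h.bounded
  have hbd : ∀ n, ‖T.rho (a n)‖ ≤ C :=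
    fun n => (NonUnitalStarAlgHom.norm_apply_le T.rho _).trans (hC n)
  refine ⟨⟨C, hbd⟩, tendsto_inner_of_dense_span hbd T.dense_span_tmul ?_⟩
  rintro _ ⟨c, h', rfl⟩ _ ⟨d, k, rfl⟩
  -- For `ρ_T` the operator T(c⋆ d) does not involve the varying element. Moved to the left vector,
  -- it leaves an ordinary matrix coefficient on H.
  have e : ∀ z : H, ⟪h', T.op (star c * d) z⟫_ℂ = ⟪adjoint (T.op (star c * d)) h', z⟫_ℂ :=
    fun z => (adjoint_inner_left _ _ _).symm
  simp only [rho_tmul, T.inner_tmul, e]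
  exact h.tendsto _ _

end NormalUCP

end Normality

/-! ### Overlaps of a finite set with its translates -/

section Overlap

variable {G : Type*} [AddCommGroup G] [DecidableEq G]

/-- The proportion `|F ∩ (F - g)| / |F|`. -/
noncomputable def overlap (F : Finset G) (g : G) : ℝ :=
  ((F.filter fun p => p + g ∈ F).card : ℝ) / F.card

theorem overlap_zero {F : Finset G} (hF : F.Nonempty) : overlap F 0 = 1 := by
  have : (F.card : ℝ) ≠ 0 := Nat.cast_ne_zero.mpr (Finset.card_pos.mpr hF).ne'
  simp [overlap, this]

theorem overlap_mul_card {F : Finset G} (hF : F.Nonempty) (g : G) :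
    overlap F g * F.card = (F.filter fun p => p + g ∈ F).card := by
  have : (F.card : ℝ) ≠ 0 := Nat.cast_ne_zero.mpr (Finset.card_pos.mpr hF).ne'
  rw [overlap, div_mul_cancel₀ _ this]

/-- The differences of elements of `F`. -/
def differences (F : Finset G) : Finset G := (F ×ˢ F).image fun p => p.1 - p.2

/-- This makes the Fejér sum over all of G a finite sum over `differences F`. -/
theorem overlap_eq_zero {F : Finset G} {g : G} (hg : g ∉ differences F) : overlap F g = 0 := by
  have : (F.filter fun p => p + g ∈ F) = ∅ := by
    refine Finset.filter_eq_empty_iff.mpr fun p hp hpg => hg ?_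
    exact Finset.mem_image.mpr ⟨(p + g, p), by simp [hp, hpg], by simp⟩
  simp [overlap, this]

/-- All the `k` for which some element of `s` lies in `F + k`. -/
def translates (s F : Finset G) : Finset G := (s ×ˢ F).image fun p => p.1 - p.2

/-- The substitution p = j − k counts the translates F + k that contain both i and j. The
restriction to `translates s F` loses nothing, since j ∈ s and j − k ∈ F already put k there. -/
theorem card_translates {s F : Finset G} {i j : G} (hj : j ∈ s) :
    ((translates s F).filter fun k => i - k ∈ F ∧ j - k ∈ F).card =
      (F.filter fun p => p + (i - j) ∈ F).card := by
  refine Finset.card_nbij' (fun k => j - k) (fun p => j - p) ?_ ?_ ?_ ?_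
  · intro k hk
    simp only [Finset.coe_filter, Set.mem_ofPred_eq] at hk ⊢
    refine ⟨hk.2.2, ?_⟩
    rw [show j - k + (i - j) = i - k by abel]
    exact hk.2.1
  · intro p hp
    simp only [Finset.coe_filter, Set.mem_ofPred_eq] at hp ⊢
    refine ⟨Finset.mem_image.mpr ⟨(j, p), by simp [hj, hp.1], rfl⟩, ?_, ?_⟩
    · rw [show i - (j - p) = p + (i - j) by abel]; exact hp.2
    · rw [sub_sub_cancel]; exact hp.1
  · intro k _; exact sub_sub_cancel j k
  · intro p _; exact sub_sub_cancel j p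

end Overlap

/-! ### Coordinates and finitely supported vectors in ℓ²(G) -/

section Delta

variable {G : Type*} [DecidableEq G]

theorem inner_delta_left (i : G) (f : lp (fun _ : G => ℂ) 2) : ⟪delta i, f⟫_ℂ = f i := by
  rw [delta, lp.inner_single_left]; simp

theorem delta_coord (i j : G) : (delta i : lp (fun _ : G => ℂ) 2) j = if j = i then 1 else 0 := by
  rw [delta, lp.single_apply, Pi.single_apply]

theorem tendsto_sum_delta (f : lp (fun _ : G => ℂ) 2) :
    Filter.Tendsto (fun s : Finset G => ∑ i ∈ s, f i • (delta i : lp (fun _ : G => ℂ) 2))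
      Filter.atTop (nhds f) := by
  have := lp.hasSum_single (p := 2) ENNReal.ofNat_ne_top f
  refine this.congr fun s => Finset.sum_congr rfl fun i _ => ?_
  rw [delta, ← lp.single_smul, smul_eq_mul, mul_one]

theorem dense_span_delta :
    Dense (Submodule.span ℂ (Set.range (delta : G → lp (fun _ : G => ℂ) 2)) :
      Set (lp (fun _ : G => ℂ) 2)) := fun f =>
  mem_closure_of_tendsto (tendsto_sum_delta f) (Filter.Eventually.of_forall fun _ =>
    Submodule.sum_mem _ fun i _ => Submodule.smul_mem _ _ (Submodule.subset_span ⟨i, rfl⟩))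

theorem inner_sum_delta (x : lp (fun _ : G => ℂ) 2 →L[ℂ] lp (fun _ : G => ℂ) 2) (s t : Finset G)
    (c d : G → ℂ) :
    ⟪∑ i ∈ s, c i • (delta i : lp (fun _ : G => ℂ) 2), x (∑ j ∈ t, d j • delta j)⟫_ℂ =
      ∑ i ∈ s, ∑ j ∈ t, star (c i) * d j * x (delta j) i := by
  simp only [map_sum, sum_inner, inner_sum, map_smul, inner_smul_left, inner_smul_right,
    inner_delta_left, Finset.mul_sum, Complex.star_def]
  rw [Finset.sum_comm]
  exact Finset.sum_congr rfl fun i _ => Finset.sum_congr rfl fun j _ => by ring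

theorem norm_sq_sum_delta (s : Finset G) (c : G → ℂ) :
    ‖∑ i ∈ s, c i • (delta i : lp (fun _ : G => ℂ) 2)‖ ^ 2 = ∑ i ∈ s, ‖c i‖ ^ 2 := by
  have h : ⟪∑ i ∈ s, c i • (delta i : lp (fun _ : G => ℂ) 2), ∑ j ∈ s, c j • delta j⟫_ℂ =
      ∑ i ∈ s, ∑ j ∈ s, star (c i) * c j * (delta j : lp (fun _ : G => ℂ) 2) i :=
    inner_sum_delta 1 s s c c
  have e : ∑ i ∈ s, ∑ j ∈ s, star (c i) * c j * (delta j : lp (fun _ : G => ℂ) 2) i =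
      ((∑ i ∈ s, ‖c i‖ ^ 2 : ℝ) : ℂ) := by
    push_cast
    refine Finset.sum_congr rfl fun i hi => ?_
    rw [Finset.sum_eq_single i]
    · rw [delta_coord, if_pos rfl, mul_one, Complex.star_def, Complex.conj_mul']
    · intro j _ hj
      rw [delta_coord, if_neg hj.symm, mul_zero]
    · exact fun h => absurd hi h
  have h' := inner_self_eq_norm_sq (𝕜 := ℂ) (∑ i ∈ s, c i • (delta i : lp (fun _ : G => ℂ) 2))
  rw [h, e] at h'
  exact h'.symm

end Delta

/-! ### Contractivity of the Fejér multiplier -/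

section Schur

variable {G : Type*} [AddCommGroup G] [DecidableEq G]
variable {x B : lp (fun _ : G => ℂ) 2 →L[ℂ] lp (fun _ : G => ℂ) 2} {F : Finset G}

/-- This is the identity |F| B = ∑ₖ Pₖ x Pₖ, tested on vectors supported in s, where Pₖ is the
coordinate projection onto F + k: the entry (i, j) survives in exactly |F| · `overlap F (i - j)` of
the compressions. Only k in `translates s F` contribute. -/
theorem card_mul_inner_schur (hF : F.Nonempty)
    (hB : ∀ i j, B (delta j) i = overlap F (i - j) * x (delta j) i) (s : Finset G) (c d : G → ℂ) :
    (F.card : ℂ) * ⟪∑ i ∈ s, c i • (delta i : lp (fun _ : G => ℂ) 2),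
        B (∑ j ∈ s, d j • delta j)⟫_ℂ =
      ∑ k ∈ translates s F, ⟪∑ i ∈ s with i - k ∈ F, c i • (delta i : lp (fun _ : G => ℂ) 2),
        x (∑ j ∈ s with j - k ∈ F, d j • delta j)⟫_ℂ := by
  simp only [inner_sum_delta]
  simp only [Finset.sum_filter, Finset.mul_sum]
  conv_rhs => rw [Finset.sum_comm]
  refine Finset.sum_congr rfl fun i _ => ?_
  have e : ∀ k, (if i - k ∈ F then ∑ j ∈ s, (if j - k ∈ F then star (c i) * d j * x (delta j) i
      else 0) else 0) = ∑ j ∈ s, if i - k ∈ F ∧ j - k ∈ F then star (c i) * d j * x (delta j) i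
      else 0 := by
    intro k
    split_ifs with h <;> simp [h]
  simp only [e]
  rw [Finset.sum_comm]
  refine Finset.sum_congr rfl fun j hj => ?_
  rw [← Finset.sum_filter, Finset.sum_const, card_translates hj, nsmul_eq_mul, hB]
  have := congrArg (fun r : ℝ => (r : ℂ)) (overlap_mul_card hF (i - j))
  simp only [Complex.ofReal_mul, Complex.ofReal_natCast] at this
  rw [← this]
  ring

/-- Every point of s lies in exactly |F| of the translates, so ∑ₖ ‖Pₖ f‖² = |F| ‖f‖². -/
theorem sum_norm_sq_translates (hF : F.Nonempty) (s : Finset G) (c : G → ℂ) :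
    ∑ k ∈ translates s F, ‖∑ i ∈ s with i - k ∈ F, c i • (delta i : lp (fun _ : G => ℂ) 2)‖ ^ 2 =
      F.card * ‖∑ i ∈ s, c i • (delta i : lp (fun _ : G => ℂ) 2)‖ ^ 2 := by
  simp only [norm_sq_sum_delta]
  simp only [Finset.sum_filter, Finset.mul_sum]
  rw [Finset.sum_comm]
  refine Finset.sum_congr rfl fun i hi => ?_
  have := card_translates (F := F) (i := i) hi
  simp only [and_self, sub_self] at this
  rw [← Finset.sum_filter, Finset.sum_const, this, nsmul_eq_mul, ← overlap_mul_card hF,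
    overlap_zero hF, one_mul]

/-- The Schur multiplier with the positive definite symbol `overlap F` is contractive. -/
theorem norm_schur_le (hF : F.Nonempty)
    (hB : ∀ i j, B (delta j) i = overlap F (i - j) * x (delta j) i) : ‖B‖ ≤ ‖x‖ := by
  have hpos : (0 : ℝ) < F.card := Nat.cast_pos.mpr (Finset.card_pos.mpr hF)
  have h1 : ∀ (s : Finset G) (c d : G → ℂ),
      ‖⟪∑ i ∈ s, c i • (delta i : lp (fun _ : G => ℂ) 2), B (∑ j ∈ s, d j • delta j)⟫_ℂ‖ ≤
        ‖x‖ * (‖∑ i ∈ s, c i • (delta i : lp (fun _ : G => ℂ) 2)‖ *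
          ‖∑ i ∈ s, d i • (delta i : lp (fun _ : G => ℂ) 2)‖) := by
    intro s c d
    -- After multiplication by |F| the form of B is a sum of forms of compressions of x.
    -- Cauchy–Schwarz over k returns two factors √|F|, which cancel the |F| just introduced.
    refine le_of_mul_le_mul_left ?_ hpos
    have e := congrArg norm (card_mul_inner_schur hF hB s c d)
    rw [norm_mul, Complex.norm_natCast] at e
    rw [e]
    set f : G → lp (fun _ : G => ℂ) 2 := fun k => ∑ i ∈ s with i - k ∈ F, c i • delta i with hf
    set g : G → lp (fun _ : G => ℂ) 2 := fun k => ∑ i ∈ s with i - k ∈ F, d i • delta i with hg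
    have hfs : ∑ k ∈ translates s F, ‖f k‖ ^ 2 = _ := sum_norm_sq_translates hF s c
    have hgs : ∑ k ∈ translates s F, ‖g k‖ ^ 2 = _ := sum_norm_sq_translates hF s d
    calc ‖∑ k ∈ translates s F, ⟪f k, x (g k)⟫_ℂ‖
        ≤ ∑ k ∈ translates s F, ‖x‖ * (‖f k‖ * ‖g k‖) := by
          refine norm_sum_le_of_le _ fun k _ => ?_
          calc _ ≤ ‖f k‖ * ‖x (g k)‖ := norm_inner_le_norm _ _
            _ ≤ ‖f k‖ * (‖x‖ * ‖g k‖) := by gcongr; exact x.le_opNorm _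
            _ = _ := by ring
      _ = ‖x‖ * ∑ k ∈ translates s F, ‖f k‖ * ‖g k‖ := by rw [Finset.mul_sum]
      _ ≤ ‖x‖ * (√(∑ k ∈ translates s F, ‖f k‖ ^ 2) * √(∑ k ∈ translates s F, ‖g k‖ ^ 2)) := by
          gcongr
          exact Real.sum_mul_le_sqrt_mul_sqrt _ _ _
      _ = _ := by
          rw [hfs, hgs, Real.sqrt_mul hpos.le, Real.sqrt_mul hpos.le, Real.sqrt_sq (norm_nonneg _),
            Real.sqrt_sq (norm_nonneg _)]
          linear_combination ‖x‖ * ‖∑ i ∈ s, c i • (delta i : lp (fun _ : G => ℂ) 2)‖ *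
            ‖∑ i ∈ s, d i • (delta i : lp (fun _ : G => ℂ) 2)‖ * Real.mul_self_sqrt hpos.le
  refine B.opNorm_le_bound (norm_nonneg _) fun f => ?_
  have h2 : ∀ u : lp (fun _ : G => ℂ) 2, ‖⟪u, B f⟫_ℂ‖ ≤ ‖x‖ * (‖u‖ * ‖f‖) := by
    intro u
    have hu := tendsto_sum_delta u
    have hf := tendsto_sum_delta f
    exact le_of_tendsto_of_tendsto' (hu.inner ((B.continuous.tendsto f).comp hf)).norm
      ((hu.norm.mul hf.norm).const_mul ‖x‖) fun s => h1 s u f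
  have h3 := h2 (B f)
  rw [inner_self_eq_norm_sq_to_K, norm_pow, RCLike.norm_ofReal, abs_norm] at h3
  rcases (norm_nonneg (B f)).eq_or_lt with h0 | h0
  · rw [← h0]; positivity
  · refine le_of_mul_le_mul_left ?_ h0
    nlinarith

end Schur

/-! ### Fejér approximation of twisted Toeplitz operators -/

section Fejer

variable {G : Type*} [AddCommGroup G] [DecidableEq G]

/-- The Fejér mean, over the finite set `F`, of an operator with the matrix entries
`x_(i,j) = w (i - j) j * x_(i-j,0)`. -/
noncomputable def fejer (w : G → G → Circle)
    (x : lp (fun _ : G => ℂ) 2 →L[ℂ] lp (fun _ : G => ℂ) 2) (F : Finset G) :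
    lp (fun _ : G => ℂ) 2 →L[ℂ] lp (fun _ : G => ℂ) 2 :=
  ∑ g ∈ differences F, ((overlap F g : ℂ) * x (delta 0) g) • shift g (w g)

/-- The shift by g has entries only on the diagonal i − j = g, so the Fejér mean of a twisted
Toeplitz operator is its Schur product with `overlap F (i - j)`. Diagonals outside `differences F`
carry overlap zero. -/
theorem fejer_delta {w : G → G → Circle} {x : lp (fun _ : G => ℂ) 2 →L[ℂ] lp (fun _ : G => ℂ) 2}
    (hx : ∀ i j, x (delta j) i = w (i - j) j * x (delta 0) (i - j)) (F : Finset G) (i j : G) :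
    fejer w x F (delta j) i = overlap F (i - j) * x (delta j) i := by
  have e : ∀ g, (((overlap F g : ℂ) * x (delta 0) g) • shift g (w g)) (delta j) i =
      if i - j = g then (overlap F g : ℂ) * x (delta 0) g * w g j else 0 := by
    intro g
    rw [smul_apply, shift_delta, lp.coeFn_smul, Pi.smul_apply, lp.coeFn_smul, Pi.smul_apply,
      delta_coord]
    by_cases h : i - j = g
    · have h' : i = g + j := by rw [← h]; abel
      rw [if_pos h, if_pos h']; simp
    · have h' : i ≠ g + j := fun h' => h (by rw [h']; abel)
      rw [if_neg h, if_neg h']; simp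
  rw [fejer, sum_apply, lp.coeFn_sum, Finset.sum_apply]
  simp only [e]
  rw [Finset.sum_ite_eq, hx i j]
  split_ifs with h
  · ring
  · rw [overlap_eq_zero h]; simp

/-- Contractivity of the multiplier bounds the sequence, which reduces weak convergence to single
matrix entries. There it is the Følner condition `hlim`. -/
theorem boundedWeakLimit_fejer {w : G → G → Circle}
    {x : lp (fun _ : G => ℂ) 2 →L[ℂ] lp (fun _ : G => ℂ) 2}
    (hx : ∀ i j, x (delta j) i = w (i - j) j * x (delta 0) (i - j)) {F : ℕ → Finset G}
    (hF : ∀ n, (F n).Nonempty)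
    (hlim : ∀ g, Filter.Tendsto (fun n => overlap (F n) g) Filter.atTop (nhds 1)) :
    BoundedWeakLimit (fun n => fejer w x (F n)) x := by
  have hbd : ∀ n, ‖fejer w x (F n)‖ ≤ ‖x‖ := fun n => norm_schur_le (hF n) (fejer_delta hx (F n))
  refine ⟨⟨_, hbd⟩, tendsto_inner_of_dense_span hbd dense_span_delta ?_⟩
  rintro _ ⟨i, rfl⟩ _ ⟨j, rfl⟩
  simp only [inner_delta_left, fejer_delta hx]
  have := ((Complex.continuous_ofReal.tendsto _).comp (hlim (i - j))).mul_const (x (delta j) i)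
  simpa using this

/-- The squares `[0, n]²` in `ℤ²`. -/
noncomputable def square (n : ℕ) : Finset (ℤ × ℤ) :=
  Finset.Ico 0 ((n : ℤ) + 1) ×ˢ Finset.Ico 0 ((n : ℤ) + 1)

theorem square_nonempty (n : ℕ) : (square n).Nonempty := ⟨(0, 0), by simp [square]⟩

theorem tendsto_overlap_Ico (g : ℤ) : Filter.Tendsto
    (fun n : ℕ => overlap (Finset.Ico 0 ((n : ℤ) + 1)) g) Filter.atTop (nhds 1) := by
  have e : ∀ᶠ n : ℕ in Filter.atTop, 1 - (|g| : ℝ) * (1 / ((n : ℝ) + 1)) =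
      overlap (Finset.Ico 0 ((n : ℤ) + 1)) g := by
    -- The interval has n + 1 points, and once n ≥ |g| it shares n + 1 − |g| of them with its
    -- translate; the ratio is 1 − |g|/(n + 1).
    filter_upwards [Filter.eventually_ge_atTop g.natAbs] with n hn
    have h1 : ((Finset.Ico 0 ((n : ℤ) + 1)).filter fun p => p + g ∈ Finset.Ico 0 ((n : ℤ) + 1)) =
        Finset.Ico (max 0 (-g)) (min ((n : ℤ) + 1) (n + 1 - g)) := by
      ext p
      simp only [Finset.mem_filter, Finset.mem_Ico]
      omega
    have h2 : ((min ((n : ℤ) + 1) (n + 1 - g) - max 0 (-g)).toNat : ℤ) = n + 1 - |g| := by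
      rw [Int.abs_eq_natAbs]
      omega
    have h3 : ((min ((n : ℤ) + 1) (n + 1 - g) - max 0 (-g)).toNat : ℝ) = n + 1 - |(g : ℝ)| := by
      exact_mod_cast h2
    have h4 : (((n : ℤ) + 1 - 0).toNat : ℝ) = n + 1 := by
      have : ((n : ℤ) + 1 - 0).toNat = n + 1 := by omega
      rw [this]; push_cast; ring
    rw [overlap, h1, Int.card_Ico, Int.card_Ico, h3, h4]
    have : (n : ℝ) + 1 ≠ 0 := by positivity
    field_simp
  refine Filter.Tendsto.congr' e ?_
  simpa using (tendsto_one_div_add_atTop_nhds_zero_nat.const_mul (|g| : ℝ)).const_sub 1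

/-- The overlap of a product set is the product of the overlaps, which reduces the claim to
intervals. -/
theorem tendsto_overlap_square (g : ℤ × ℤ) :
    Filter.Tendsto (fun n => overlap (square n) g) Filter.atTop (nhds 1) := by
  have e : ∀ n, overlap (square n) g = overlap (Finset.Ico 0 ((n : ℤ) + 1)) g.1 *
      overlap (Finset.Ico 0 ((n : ℤ) + 1)) g.2 := by
    intro n
    have : ((square n).filter fun p => p + g ∈ square n) =
        ((Finset.Ico 0 ((n : ℤ) + 1)).filter fun p => p + g.1 ∈ Finset.Ico 0 ((n : ℤ) + 1)) ×ˢ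
        ((Finset.Ico 0 ((n : ℤ) + 1)).filter fun p => p + g.2 ∈ Finset.Ico 0 ((n : ℤ) + 1)) := by
      ext p
      simp only [square, Finset.mem_filter, Finset.mem_product, Prod.fst_add, Prod.snd_add]
      tauto
    rw [overlap, this, square, Finset.card_product, Finset.card_product, overlap, overlap,
      div_mul_div_comm]
    push_cast
    rfl
  simp only [e]
  simpa using (tendsto_overlap_Ico g.1).mul (tendsto_overlap_Ico g.2)

end Fejer

/-! ### Polynomials in the generators are weakly dense in A and in A' -/

section Rotation

variable (θ : ℝ)

/-- The phase in `U_l^m V_l^n δ_j = λ^(-n j₁) δ_((m,n)+j)`. -/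
noncomputable def weightL (g j : ℤ × ℤ) : Circle := (lam θ) ^ (-(g.2 * j.1))

/-- The phase in `V_r^n U_r^m δ_j = λ^(-m j₂) δ_((m,n)+j)`. -/
noncomputable def weightR (g j : ℤ × ℤ) : Circle := (lam θ) ^ (-(g.1 * j.2))

/-- A sequence of operators obtained by repeated multiplication by a unitary stays in every
`*`-algebra that contains the unitary and the initial operator. -/
theorem mem_of_unitary_mul {D : Type*} [Ring D] [StarRing D] [Algebra ℂ D] [StarModule ℂ D]
    (S : StarSubalgebra ℂ D) {u : D} (hu : u ∈ unitary D) (huS : u ∈ S) {f : ℤ → D}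
    (h0 : f 0 ∈ S) (hf : ∀ n, u * f n = f (n + 1)) (n : ℤ) : f n ∈ S := by
  induction n with
  | zero => exact h0
  | succ n ih => rw [← hf]; exact mul_mem huS ih
  | pred n ih =>
    have e : star u * f (-n) = f (-n - 1) := by
      rw [← sub_add_cancel (-(n : ℤ)) 1, ← hf, ← mul_assoc, (Unitary.mem_iff.mp hu).1, one_mul]
      simp
    rw [← e]
    exact mul_mem (star_mem huS) ih

theorem shift_zero_eq_one {G : Type*} [AddCommGroup G] : shift (0 : G) (fun _ => 1) = 1 := by
  ext f i
  rw [shift_apply]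
  simp

/-- The powers of V are built up from the identity and then multiplied by powers of U. In this order
only V contributes a phase, and the accumulated phase is exactly `weightL`. -/
theorem shift_weightL_mem {S : StarSubalgebra ℂ (Hτ →L[ℂ] Hτ)} (hU : Ul ∈ S) (hV : Vl θ ∈ S)
    (g : ℤ × ℤ) : shift g (weightL θ g) ∈ S := by
  obtain ⟨m, n⟩ := g
  refine mem_of_unitary_mul S (shift_mem_unitary _ _) hU (f := fun m => shift (m, n) (weightL θ (m, n)))
    (mem_of_unitary_mul S (shift_mem_unitary _ _) hV
      (f := fun n => shift (0, n) (weightL θ (0, n))) ?_ (fun n => ?_) n) (fun m => ?_) m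
  · have : shift ((0, 0) : ℤ × ℤ) (weightL θ (0, 0)) = 1 := by
      rw [← shift_zero_eq_one]
      congr 1
      funext j; simp [weightL]
    rw [this]; exact one_mem S
  · refine (shift_mul _ _ _ _).trans ?_
    congr 1
    · ext <;> simp [add_comm]
    · funext j
      simp only [phaseL, weightL, Prod.fst_add, ← zpow_add]
      congr 1; ring
  · refine (shift_mul _ _ _ _).trans ?_
    congr 1
    · ext <;> simp [add_comm]
    · funext j
      simp [weightL]

/-- Here the roles are exchanged: the powers of `Ur` come first and carry the phase, and `Vr` is
then applied without one. -/
theorem shift_weightR_mem {S : StarSubalgebra ℂ (Hτ →L[ℂ] Hτ)} (hU : Ur θ ∈ S) (hV : Vr ∈ S)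
    (g : ℤ × ℤ) : shift g (weightR θ g) ∈ S := by
  obtain ⟨m, n⟩ := g
  refine mem_of_unitary_mul S (shift_mem_unitary _ _) hV (f := fun n => shift (m, n) (weightR θ (m, n)))
    (mem_of_unitary_mul S (shift_mem_unitary _ _) hU
      (f := fun m => shift (m, 0) (weightR θ (m, 0))) ?_ (fun m => ?_) m) (fun n => ?_) n
  · have : shift ((0, 0) : ℤ × ℤ) (weightR θ (0, 0)) = 1 := by
      rw [← shift_zero_eq_one]
      congr 1
      funext j; simp [weightR]
    rw [this]; exact one_mem S
  · refine (shift_mul _ _ _ _).trans ?_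
    congr 1
    · ext <;> simp [add_comm]
    · funext j
      simp only [phaseR, weightR, Prod.snd_add, ← zpow_add]
      congr 1; ring
  · refine (shift_mul _ _ _ _).trans ?_
    congr 1
    · ext <;> simp [add_comm]
    · funext j
      simp [weightR]

/-- The `*`-algebra generated by `U_l` and `V_l` in the factor. -/
noncomputable def polyL : StarSubalgebra ℂ (Elem (factor θ)) :=
  StarAlgebra.adjoin ℂ {UlElem θ, VlElem θ}

/-- The `*`-algebra generated by `U_r` and `V_r` in the commutant of the factor. -/
noncomputable def polyR : StarSubalgebra ℂ (Elem (factor θ).commutant) :=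
  StarAlgebra.adjoin ℂ {UrElem θ, VrElem θ}

theorem exists_polyL_eq_shift (g : ℤ × ℤ) :
    ∃ y ∈ polyL θ, (y : Hτ →L[ℂ] Hτ) = shift g (weightL θ g) :=
  shift_weightL_mem θ (S := (polyL θ).map (factor θ).toStarSubalgebra.subtype)
    ⟨UlElem θ, StarAlgebra.subset_adjoin ℂ _ (by simp), rfl⟩
    ⟨VlElem θ, StarAlgebra.subset_adjoin ℂ _ (by simp), rfl⟩ g

theorem exists_polyR_eq_shift (g : ℤ × ℤ) :
    ∃ y ∈ polyR θ, (y : Hτ →L[ℂ] Hτ) = shift g (weightR θ g) :=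
  shift_weightR_mem θ (S := (polyR θ).map (factor θ).commutant.toStarSubalgebra.subtype)
    ⟨UrElem θ, StarAlgebra.subset_adjoin ℂ _ (by simp), rfl⟩
    ⟨VrElem θ, StarAlgebra.subset_adjoin ℂ _ (by simp), rfl⟩ g

theorem shift_delta_zero {G : Type*} [AddCommGroup G] [DecidableEq G] {g : G} {w : G → Circle}
    (hw : w 0 = 1) : shift g w (delta 0) = delta g := by
  rw [shift_delta, hw, add_zero]; simp

/-- The matrix entries of an operator that commutes with the weighted shifts. -/
theorem coord_of_commute_shift {G : Type*} [AddCommGroup G] [DecidableEq G] {w w' : G → G → Circle}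
    (hw : ∀ g, w g 0 = 1) (hww : ∀ g j, w g j = w' j g)
    {x : lp (fun _ : G => ℂ) 2 →L[ℂ] lp (fun _ : G => ℂ) 2}
    (hx : ∀ g f, x (shift g (w g) f) = shift g (w g) (x f)) (i j : G) :
    x (delta j) i = w' (i - j) j * x (delta 0) (i - j) := by
  -- δ_j is the commuting shift by j applied to δ_0, so column j of x is a shifted column 0. The
  -- symmetry `hww` rewrites the resulting phase `w j (i - j)` as `w' (i - j) j`, the weight of the
  -- opposite family.
  rw [← shift_delta_zero (hw j), hx, shift_apply, hww]

/-- This is an explicit, sequential form of Kaplansky density. Commutation with the right shifts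
makes a twisted Toeplitz with the left weights, and its Fejér means over the squares are
combinations of the left shifts. -/
theorem exists_boundedWeakLimit_polyL (a : Elem (factor θ)) :
    ∃ y : ℕ → Elem (factor θ), (∀ n, y n ∈ polyL θ) ∧
      BoundedWeakLimit (fun n => (y n : Hτ →L[ℂ] Hτ)) a := by
  choose L hL hL' using exists_polyL_eq_shift θ
  have hx : ∀ i j, (a : Hτ →L[ℂ] Hτ) (delta j) i =
      weightL θ (i - j) j * (a : Hτ →L[ℂ] Hτ) (delta 0) (i - j) := by
    refine coord_of_commute_shift (w := weightR θ) (fun g => by simp [weightR])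
      (fun g j => by simp [weightR, weightL, mul_comm]) fun g f => ?_
    obtain ⟨y, -, hy⟩ := exists_polyR_eq_shift θ g
    rw [← hy]
    exact commute_of_mem_commutant _ a y f
  refine ⟨fun n => ∑ g ∈ differences (square n),
    ((overlap (square n) g : ℂ) * (a : Hτ →L[ℂ] Hτ) (delta 0) g) • L g,
    fun n => sum_mem fun g _ => SMulMemClass.smul_mem _ (hL g), ?_⟩
  have := boundedWeakLimit_fejer hx square_nonempty tendsto_overlap_square
  convert this using 2 with n
  rw [fejer]
  simp [hL']

theorem exists_boundedWeakLimit_polyR (a : Elem (factor θ).commutant) :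
    ∃ y : ℕ → Elem (factor θ).commutant, (∀ n, y n ∈ polyR θ) ∧
      BoundedWeakLimit (fun n => (y n : Hτ →L[ℂ] Hτ)) a := by
  choose R hR hR' using exists_polyR_eq_shift θ
  have hx : ∀ i j, (a : Hτ →L[ℂ] Hτ) (delta j) i =
      weightR θ (i - j) j * (a : Hτ →L[ℂ] Hτ) (delta 0) (i - j) := by
    refine coord_of_commute_shift (w := weightL θ) (fun g => by simp [weightL])
      (fun g j => by simp [weightR, weightL, mul_comm]) fun g f => ?_
    obtain ⟨y, -, hy⟩ := exists_polyL_eq_shift θ g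
    rw [← hy]
    exact (commute_of_mem_commutant _ y a f).symm
  refine ⟨fun n => ∑ g ∈ differences (square n),
    ((overlap (square n) g : ℂ) * (a : Hτ →L[ℂ] Hτ) (delta 0) g) • R g,
    fun n => sum_mem fun g _ => SMulMemClass.smul_mem _ (hR g), ?_⟩
  have := boundedWeakLimit_fejer hx square_nonempty tendsto_overlap_square
  convert this using 2 with n
  rw [fejer]
  simp [hR']

end Rotation

/-! ### Passing between `A_θ^(2)` and the algebraic tensor product -/

section Intertwining

variable {θ : ℝ} {T S : NormalUCP (factor θ)}

/-- The conjugate of a representation by a unitary. -/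
noncomputable def conjRep {B : Type*} [Semiring B] [StarRing B] [Algebra ℂ B]
    {K₁ : Type*} [NormedAddCommGroup K₁] [InnerProductSpace ℂ K₁] [CompleteSpace K₁]
    {K₂ : Type*} [NormedAddCommGroup K₂] [InnerProductSpace ℂ K₂] [CompleteSpace K₂]
    (W : K₁ ≃ₗᵢ[ℂ] K₂) (π₁ : B →⋆ₐ[ℂ] (K₁ →L[ℂ] K₁)) : B →⋆ₐ[ℂ] (K₂ →L[ℂ] K₂) :=
  (W.conjStarAlgEquiv : (K₁ →L[ℂ] K₁) →⋆ₐ[ℂ] (K₂ →L[ℂ] K₂)).comp π₁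

theorem intertwines_iff_conjRep_eq {B : Type*} [Semiring B] [StarRing B] [Algebra ℂ B]
    {K₁ : Type*} [NormedAddCommGroup K₁] [InnerProductSpace ℂ K₁] [CompleteSpace K₁]
    {K₂ : Type*} [NormedAddCommGroup K₂] [InnerProductSpace ℂ K₂] [CompleteSpace K₂]
    {π₁ : B →⋆ₐ[ℂ] (K₁ →L[ℂ] K₁)} {π₂ : B →⋆ₐ[ℂ] (K₂ →L[ℂ] K₂)} (W : K₁ ≃ₗᵢ[ℂ] K₂) (x : B) :
    (∀ k, W (π₁ x k) = π₂ x (W k)) ↔ conjRep W π₁ x = π₂ x := by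
  constructor
  · intro h
    ext k
    change W (π₁ x (W.symm k)) = π₂ x k
    rw [h, LinearIsometryEquiv.apply_symm_apply]
  · intro h k
    rw [← h]
    change _ = W (π₁ x (W.symm (W k)))
    rw [LinearIsometryEquiv.symm_apply_apply]

/-- Bounded weak limits preserve intertwining relations. -/
theorem BoundedWeakLimit.intertwines {K₁ : Type*} [NormedAddCommGroup K₁] [InnerProductSpace ℂ K₁]
    {K₂ : Type*} [NormedAddCommGroup K₂] [InnerProductSpace ℂ K₂] {X : ℕ → K₁ →L[ℂ] K₁}
    {X' : K₁ →L[ℂ] K₁} {Y : ℕ → K₂ →L[ℂ] K₂} {Y' : K₂ →L[ℂ] K₂} (hX : BoundedWeakLimit X X')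
    (hY : BoundedWeakLimit Y Y') (W : K₁ ≃ₗᵢ[ℂ] K₂) (h : ∀ n k, W (X n k) = Y n (W k)) (k : K₁) :
    W (X' k) = Y' (W k) := by
  refine ext_inner_left ℂ fun u => ?_
  have h1 := hX.tendsto (W.symm u) k
  have h2 := hY.tendsto u (W k)
  have e : ∀ z, ⟪W.symm u, z⟫_ℂ = ⟪u, W z⟫_ℂ := fun z => by
    rw [← W.inner_map_map, LinearIsometryEquiv.apply_symm_apply]
  simp only [e, h] at h1
  exact tendsto_nhds_unique h1 h2

/-- Representations of `A_θ^(2)` that agree on the generators are equal. -/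
theorem starAlgHom_ext_Atheta2 {K : Type*} [NormedAddCommGroup K] [InnerProductSpace ℂ K]
    [CompleteSpace K] {φ ψ : Atheta2 θ →⋆ₐ[ℂ] (K →L[ℂ] K)} (h1 : φ (Ul2Elem θ) = ψ (Ul2Elem θ))
    (h2 : φ (Vl2Elem θ) = ψ (Vl2Elem θ)) (h3 : φ (Ur2Elem θ) = ψ (Ur2Elem θ))
    (h4 : φ (Vr2Elem θ) = ψ (Vr2Elem θ)) : φ = ψ := by
  have hcont : ∀ χ : Atheta2 θ →⋆ₐ[ℂ] (K →L[ℂ] K), Continuous χ := fun χ =>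
    AddMonoidHomClass.continuous_of_bound χ 1 fun x => by
      rw [one_mul]; exact NonUnitalStarAlgHom.norm_apply_le χ x
  refine StarAlgHom.ext_topologicalClosure (S := Afin θ) (hcont φ) (hcont ψ) ?_
  refine StarAlgHom.ext_adjoin fun x hx => ?_
  obtain ⟨x, hx'⟩ := x
  rcases hx with rfl | rfl | rfl | rfl
  exacts [h1, h2, h3, h4]

theorem unitarilyEquivalent_piTilde_of_piTildeAlg
    (h : UnitarilyEquivalent T.piTildeAlg S.piTildeAlg) :
    UnitarilyEquivalent (piTilde T) (piTilde S) := by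
  obtain ⟨W, hpi, hrho⟩ := NormalUCP.unitarilyEquivalent_piTildeAlg_iff.mp h
  obtain ⟨t1, t2, t3, t4⟩ := piTilde_gen T
  obtain ⟨s1, s2, s3, s4⟩ := piTilde_gen S
  -- Conjugation by W turns the intertwining relation into an equality of two representations on the
  -- same space, which can be tested on the four generators.
  have e : conjRep W (piTilde T) = piTilde S := by
    refine starAlgHom_ext_Atheta2 ?_ ?_ ?_ ?_ <;> rw [← intertwines_iff_conjRep_eq]
    · rw [t1, s1]; exact hpi _
    · rw [t2, s2]; exact hpi _
    · rw [t3, s3]; exact hrho _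
    · rw [t4, s4]; exact hrho _
  exact ⟨W, fun x => (intertwines_iff_conjRep_eq W x).mpr (DFunLike.congr_fun e x)⟩

/-- The relation on the generators gives it on the polynomials. Fejér sequences carry it to the weak
closures, because `π` and `ρ` take the same bounded weak limit on both sides. -/
theorem unitarilyEquivalent_piTildeAlg_of_piTilde
    (h : UnitarilyEquivalent (piTilde T) (piTilde S)) :
    UnitarilyEquivalent T.piTildeAlg S.piTildeAlg := by
  obtain ⟨W, hW⟩ := h
  obtain ⟨t1, t2, t3, t4⟩ := piTilde_gen T
  obtain ⟨s1, s2, s3, s4⟩ := piTilde_gen S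
  have hpi : ∀ a ∈ polyL θ, ∀ k, W (T.pi a k) = S.pi a (W k) := by
    intro a ha
    rw [intertwines_iff_conjRep_eq]
    refine StarAlgHom.adjoin_le_equalizer (conjRep W T.pi) S.pi ?_ ha
    rintro _ (rfl | rfl) <;> rw [← intertwines_iff_conjRep_eq]
    · rw [← t1, ← s1]; exact hW _
    · rw [← t2, ← s2]; exact hW _
  have hrho : ∀ c ∈ polyR θ, ∀ k, W (T.rho c k) = S.rho c (W k) := by
    intro c hc
    rw [intertwines_iff_conjRep_eq]
    refine StarAlgHom.adjoin_le_equalizer (conjRep W T.rho) S.rho ?_ hc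
    rintro _ (rfl | rfl) <;> rw [← intertwines_iff_conjRep_eq]
    · rw [← t3, ← s3]; exact hW _
    · rw [← t4, ← s4]; exact hW _
  refine NormalUCP.unitarilyEquivalent_piTildeAlg_iff.mpr ⟨W, fun a k => ?_, fun c k => ?_⟩
  · obtain ⟨y, hy, hlim⟩ := exists_boundedWeakLimit_polyL θ a
    exact (T.boundedWeakLimit_pi hlim).intertwines (S.boundedWeakLimit_pi hlim) W
      (fun n => hpi _ (hy n)) k
  · obtain ⟨y, hy, hlim⟩ := exists_boundedWeakLimit_polyR θ c
    exact (T.boundedWeakLimit_rho hlim).intertwines (S.boundedWeakLimit_rho hlim) W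
      (fun n => hrho _ (hy n)) k

end Intertwining

/-! ### Cyclicity of `ξ_T 1` and the GNS representation of `ψ_T` -/

section Cyclic

variable {θ : ℝ} (T : NormalUCP (factor θ))

theorem exists_piTilde_eq_pi {a : Elem (factor θ)} (ha : a ∈ polyL θ) :
    ∃ x, piTilde T x = T.pi a := by
  obtain ⟨t1, t2, -, -⟩ := piTilde_gen T
  have : polyL θ ≤ (piTilde T).range.comap T.pi := by
    refine StarAlgebra.adjoin_le ?_
    rintro _ (rfl | rfl)
    exacts [⟨_, t1⟩, ⟨_, t2⟩]
  exact this ha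

theorem exists_piTilde_eq_rho {c : Elem (factor θ).commutant} (hc : c ∈ polyR θ) :
    ∃ x, piTilde T x = T.rho c := by
  obtain ⟨-, -, t3, t4⟩ := piTilde_gen T
  have : polyR θ ≤ (piTilde T).range.comap T.rho := by
    refine StarAlgebra.adjoin_le ?_
    rintro _ (rfl | rfl)
    exacts [⟨_, t3⟩, ⟨_, t4⟩]
  exact this hc

/-- The vector `ξ_T 1` is cyclic for `π̃_T`. -/
theorem dense_span_piTilde_xi : Dense (Submodule.span ℂ
    (Set.range fun x : Atheta2 θ => piTilde T x (T.xi vacuum)) : Set T.Space) := by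
  set V := (Submodule.span ℂ
    (Set.range fun x : Atheta2 θ => piTilde T x (T.xi vacuum))).topologicalClosure with hV
  have hcl : IsClosed (V : Set T.Space) := Submodule.isClosed_topologicalClosure _
  have hcs : CompleteSpace V := hcl.completeSpace_coe
  have hinv : ∀ x, ∀ z ∈ V, piTilde T x z ∈ V := by
    intro x z hz
    refine map_mem_closure (piTilde T x).continuous hz fun w hw => ?_
    induction hw using Submodule.span_induction with
    | mem w hw =>
      obtain ⟨y, rfl⟩ := hw
      refine Submodule.subset_span ⟨x * y, ?_⟩
      simp [map_mul]
    | zero => rw [map_zero]; exact Submodule.zero_mem _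
    | add u v _ _ hu hv => rw [map_add]; exact Submodule.add_mem _ hu hv
    | smul c u _ hu => rw [map_smul]; exact Submodule.smul_mem _ c hu
  -- The right shift by g sends 1 = δ_0 to δ_g without a phase, and `ρ_T` acts on the second leg of
  -- 1 ⊗ δ_0.
  have hdelta : ∀ g, T.xi (delta g) ∈ V := by
    intro g
    obtain ⟨c, hc, hg⟩ := exists_polyR_eq_shift θ g
    obtain ⟨x, hx⟩ := exists_piTilde_eq_rho T hc
    refine subset_closure (Submodule.subset_span ⟨x, ?_⟩)
    change piTilde T x (T.xi vacuum) = _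
    rw [hx, NormalUCP.xi_apply, NormalUCP.rho_tmul, hg, vacuum,
      shift_delta_zero (by simp [weightR]), NormalUCP.xi_apply]
  have hxi : ∀ h, T.xi h ∈ V := by
    intro h
    have := map_mem_closure T.xi.continuous (dense_span_delta h)
      (t := (V : Set T.Space)) fun w hw => by
        induction hw using Submodule.span_induction with
        | mem w hw => obtain ⟨g, rfl⟩ := hw; exact hdelta g
        | zero => rw [map_zero]; exact Submodule.zero_mem _
        | add u v _ _ hu hv => rw [map_add]; exact Submodule.add_mem _ hu hv
        | smul c u _ hu => rw [map_smul]; exact Submodule.smul_mem _ c hu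
    rwa [hcl.closure_eq] at this
  have htmul : ∀ a h, T.tmul a h ∈ V := by
    intro a h
    obtain ⟨y, hy, hlim⟩ := exists_boundedWeakLimit_polyL θ a
    -- The approximation of a is only weak. Since V is closed it equals its double orthogonal
    -- complement, so membership can be tested against each z orthogonal to V, where the
    -- approximants give 0.
    rw [← T.pi_xi_apply, ← Submodule.orthogonal_orthogonal V, Submodule.mem_orthogonal]
    intro z hz
    refine tendsto_nhds_unique ((T.boundedWeakLimit_pi hlim).tendsto z (T.xi h)) ?_
    have e : ∀ n, ⟪z, T.pi (y n) (T.xi h)⟫_ℂ = 0 := by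
      intro n
      obtain ⟨x, hx⟩ := exists_piTilde_eq_pi T (hy n)
      rw [← hx]
      exact Submodule.inner_left_of_mem_orthogonal (hinv x _ (hxi h)) hz
    simp only [e]
    exact tendsto_const_nhds
  intro z
  have h1 := closure_minimal (s := (Submodule.span ℂ {x : T.Space | ∃ a h, x = T.tmul a h} : Set _))
    (t := (V : Set T.Space)) (Submodule.span_le.mpr (by rintro _ ⟨a, h, rfl⟩; exact htmul a h)) hcl
  exact h1 (T.dense_span_tmul z)

/-- A cyclic representation is the GNS representation of its vector functional. -/
theorem unitarilyEquivalent_gns {B : Type*} [CStarAlgebra B] [PartialOrder B] [StarOrderedRing B]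
    {K : Type*} [NormedAddCommGroup K] [InnerProductSpace ℂ K] [CompleteSpace K]
    {π : B →⋆ₐ[ℂ] (K →L[ℂ] K)} {k : K} {f : B →ₚ[ℂ] ℂ} (hf : ∀ x, f x = ⟪k, π x k⟫_ℂ)
    (hk : Dense (Submodule.span ℂ (Set.range fun x => π x k) : Set K)) :
    UnitarilyEquivalent f.gnsStarAlgHom π := by
  have hu : Dense (Submodule.span ℂ
      (Set.range fun x : B => ((f.toPreGNS x : f.PreGNS) : f.GNS)) : Set f.GNS) := by
    refine (UniformSpace.Completion.denseRange_coe (α := f.PreGNS)).mono ?_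
    rintro _ ⟨x, rfl⟩
    exact Submodule.subset_span ⟨f.ofPreGNS x, rfl⟩
  -- Both families, indexed by the algebra itself, have the Gram matrix f(x⋆y).
  obtain ⟨W, hW⟩ := exists_linearIsometryEquiv_of_inner_eq
    (fun x : B => ((f.toPreGNS x : f.PreGNS) : f.GNS)) (fun x => π x k) hu hk fun x y => by
      rw [UniformSpace.Completion.inner_coe, PositiveLinearMap.preGNS_inner_def,
        PositiveLinearMap.ofPreGNS_toPreGNS, PositiveLinearMap.ofPreGNS_toPreGNS, hf, map_mul,
        map_star, mul_apply_eq_comp, star_eq_adjoint, adjoint_inner_right]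
  refine ⟨W, fun x => ?_⟩
  let W' : f.GNS →L[ℂ] K := W.toLinearIsometry.toContinuousLinearMap
  suffices e : W' ∘L f.gnsStarAlgHom x = π x ∘L W' from fun z => congrArg (fun X => X z) e
  refine ext_on hu ?_
  rintro _ ⟨y, rfl⟩
  change W (f.gnsNonUnitalStarAlgHom x (f.toPreGNS y : f.PreGNS)) = π x (W (f.toPreGNS y : f.PreGNS))
  rw [PositiveLinearMap.gnsNonUnitalStarAlgHom_apply_coe]
  change W (f.toPreGNS (x * y) : f.PreGNS) = _
  rw [hW, hW, map_mul, mul_apply_eq_comp]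

theorem unitarilyEquivalent_gns_psi :
    UnitarilyEquivalent (psi T).gnsStarAlgHom (piTilde T) :=
  unitarilyEquivalent_gns (psi_apply T) (dense_span_piTilde_xi T)

end Cyclic

end CPMaps

theorem proposition123 (θ : ℝ) (hθ : Irrational θ) (T S : CPMaps.NormalUCP (CPMaps.factor θ)) :
    (CPMaps.NormalUCP.KSGNSEquivalent T S ↔
      CPMaps.UnitarilyEquivalent (CPMaps.psi T).gnsStarAlgHom (CPMaps.psi S).gnsStarAlgHom) ∧
    (CPMaps.NormalUCP.KSGNSEquivalent T S ↔
      CPMaps.UnitarilyEquivalent (CPMaps.piTilde T) (CPMaps.piTilde S)) ∧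
    (CPMaps.NormalUCP.KSGNSEquivalent T S ↔
      CPMaps.UnitarilyEquivalent T.piTildeAlg S.piTildeAlg) := by
  have h1 : CPMaps.NormalUCP.KSGNSEquivalent T S ↔
      CPMaps.UnitarilyEquivalent T.piTildeAlg S.piTildeAlg := CPMaps.NormalUCP.kSGNSEquivalent_iff
  have h2 : CPMaps.NormalUCP.KSGNSEquivalent T S ↔
      CPMaps.UnitarilyEquivalent (CPMaps.piTilde T) (CPMaps.piTilde S) :=
    h1.trans ⟨CPMaps.unitarilyEquivalent_piTilde_of_piTildeAlg,
      CPMaps.unitarilyEquivalent_piTildeAlg_of_piTilde⟩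
  have hT := CPMaps.unitarilyEquivalent_gns_psi T
  have hS := CPMaps.unitarilyEquivalent_gns_psi S
  exact ⟨h2.trans ⟨fun h => (hT.trans h).trans hS.symm, fun h => (hT.symm.trans h).trans hS⟩,
    h2, h1⟩
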